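/- **Setting.** Let $d,L,M\ge 1$ and consider the $L\times M$ square lattice with periodic boundary conditions. A spin $\mathbb C^d$ with basis $|n\rangle$, $n\in\mathbb Z_d$, sits on each bond; horizontal bonds are oriented to the right, vertical bonds upwards. For a bond $b$ let $X_b|n\rangle=|n+1\rangle$. For a site $v$ let $A_m(v)=\prod_b X_b^{\pm m}$ over the four bonds at $v$ (sign $+$ for bonds leaving $v$, $-$ for bonds entering $v$) and $A(v)=\frac1d\sum_{m\in\mathbb Z_d} A_m(v)$. For a plaquette $p$ let $B(p)$ be the projector onto the span of the basis states whose oriented sum of spins around $p$ is $0$ mod $d$. The ground state manifold is $\mathcal L=\{\psi: A(v)\psi=\psi,\ B(p)\psi=\psi \text{ for all } v,p\}$. Let $\Psi_0=|\psi\rangle\langle\psi|$ with $\psi\in\mathcal L$, $\|\psi\|=1$. For a set $\Lambda$ of bonds, $P_\Lambda=\operatorname{tr}[(\operatorname{tr}_{\bar\Lambda}\Psi_0)^2]$, and for sets of bonds $A,B,C$, $$P_{top}(A,B,C)=\frac{P_{A\cup B}\,P_{B\cup C}}{P_B\,P_{A\cup B\cup C}}.$$ Two bonds are adjacent if they share an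 endpoint; two sets of bonds touch if a bond of one equals, or shares an endpoint with, a bond of the other. The boundary $\partial\Lambda$ is the set of sites at which both a bond of $\Lambda$ and a bond of $\bar\Lambda$ end; $n_i(\Lambda)$ is the number of sites of $\partial\Lambda$ at which exactly $i$ bonds of $\Lambda$ end; $\gamma_\Lambda=\log_2 d\,(n_2(\Lambda)+2n_3(\Lambda))$; and $n_\partial(\Lambda)$ is the number of boundaries of $\Lambda$, i.e. of pairs (connected component of $\Lambda$, connected component of $\bar\Lambda$) that meet at a site. Put $\gamma=\log_2 d$. Let $A,B,C$ form an annular configuration: $A\cap B=B\cap C=\emptyset$; $A$ and $C$ do not touch; $A\cup B\cup C$ is connected and its complement has two connected components; $A\cup B$ and $B\cup C$ are connected with connected complement; $B$ has two connected components and connected complement. **Lemma 1.** Let $X$ be a set of bonds such that $A\cup B\cup C\cup X$ lies in a contractible patch of the torus (it avoids all sites of some row and of some column), and $n_\partial(A\cup B\cup C\cup X)=n_\partial(A\cup B\cup C)$. Let $X$ deform $(A,B,C)$ locally into $(A',B',C')$, that is, one of the following holds: $(A',B',C')=(A\cup X,B,C)$ and $X$ does not touch $C$; or $(A',B',C')=(A,B,C\cup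 X)$ and $X$ does not touch $A$; or $(A',B',C')=(A,B\cup X,C)$ and $X$ touches neither $A$ nor $C$, and touches at most one connected component of $B$. Then $$P_{top}(A',B',C')=P_{top}(A,B,C)=2^{-2\gamma}.$$ Moreover the boundary lengths and the shape corrections cancel in the ratio: $$|\partial(A'\cup B')|+|\partial(B'\cup C')|=|\partial B'|+|\partial(A'\cup B'\cup C')|,\qquad \gamma_{A'\cup B'}+\gamma_{B'\cup C'}=\gamma_{B'}+\gamma_{A'\cup B'\cup C'}.$$ -/

import Mathlib

namespace QuantumDouble

/-! The lattice: an `L × M` square lattice with periodic boundary conditions. -/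

/-- Sites (vertices) of the lattice. Plaquettes are labelled by their lower left corner. -/
abbrev Site (L M : ℕ) : Type := ZMod L × ZMod M

/-- Bonds (edges): `(v, false)` is the horizontal bond from `v` to its right neighbour,
`(v, true)` is the vertical bond from `v` to its upper neighbour. The spins live on the bonds. -/
abbrev Bond (L M : ℕ) : Type := Site L M × Bool

/-- The neighbour of `v` to the right. -/
def right {L M : ℕ} (v : Site L M) : Site L M := (v.1 + 1, v.2)

/-- The neighbour of `v` to the left. -/
def left {L M : ℕ} (v : Site L M) : Site L M := (v.1 - 1, v.2)

/-- The neighbour of `v` above. -/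
def up {L M : ℕ} (v : Site L M) : Site L M := (v.1, v.2 + 1)

/-- The neighbour of `v` below. -/
def down {L M : ℕ} (v : Site L M) : Site L M := (v.1, v.2 - 1)

/-- Initial site of an oriented bond. -/
def tail {L M : ℕ} (b : Bond L M) : Site L M := b.1

/-- Final site of an oriented bond. -/
def head {L M : ℕ} (b : Bond L M) : Site L M := if b.2 then up b.1 else right b.1

/-- The site `v` is an endpoint of the bond `b`. -/
def Inc {L M : ℕ} (v : Site L M) (b : Bond L M) : Prop := v = tail b ∨ v = head b

/-! Operators on the Hilbert space `⨂_b ℂ^d`. Its computational basis is indexed by the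
configurations, so vectors are functions and operators are matrices on configurations. -/

/-- Basis labels: one element of `ℤ_d` for each bond. -/
abbrev Config (d L M : ℕ) : Type := Bond L M → ZMod d

section Operators

variable {d L M : ℕ} [NeZero d] [NeZero L] [NeZero M]

/-- `X_b^m`, which sends `|n⟩` to `|n + m⟩` on the bond `b`. -/
def shiftOp (b : Bond L M) (m : ZMod d) : Matrix (Config d L M) (Config d L M) ℂ :=
  fun σ τ => if σ = Function.update τ b (τ b + m) then 1 else 0

/-- `T_b^{(m)}`, the projector on `|m⟩` on the bond `b`. -/
def projOp (b : Bond L M) (m : ZMod d) : Matrix (Config d L M) (Config d L M) ℂ :=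
  Matrix.diagonal fun σ => if σ b = m then 1 else 0

/-- `A_m(v)`: shifts by `m` the two bonds leaving `v` and by `-m` the two bonds entering `v`. -/
def starOp (m : ZMod d) (v : Site L M) : Matrix (Config d L M) (Config d L M) ℂ :=
  shiftOp (v, false) m * shiftOp (v, true) m *
    shiftOp (left v, false) (-m) * shiftOp (down v, true) (-m)

/-- The star projector `A(v) = d⁻¹ ∑_m A_m(v)`. -/
noncomputable def starProj (v : Site L M) : Matrix (Config d L M) (Config d L M) ℂ :=
  (d : ℂ)⁻¹ • ∑ m : ZMod d, starOp m v

/-- The plaquette projector `B(p)`: the oriented sum of the spins around the plaquette with lower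
left corner `p` vanishes. -/
noncomputable def plaqProj (p : Site L M) : Matrix (Config d L M) (Config d L M) ℂ :=
  ∑ m : Fin 4 → ZMod d, if m 0 + m 1 - m 2 - m 3 = 0 then
    projOp (p, false) (m 0) * projOp (right p, true) (m 1) *
      projOp (up p, false) (m 2) * projOp (p, true) (m 3) else 0

/-- The ground state manifold `{ψ | A(v) ψ = ψ for all v and B(p) ψ = ψ for all p}`. -/
def groundSpace (d L M : ℕ) [NeZero d] [NeZero L] [NeZero M] : Set (Config d L M → ℂ) :=
  {ψ | (∀ v, (starProj v).mulVec ψ = ψ) ∧ ∀ p, (plaqProj p).mulVec ψ = ψ}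

/-- The density matrix `|ψ⟩⟨ψ|`. -/
def pureState (ψ : Config d L M → ℂ) : Matrix (Config d L M) (Config d L M) ℂ :=
  Matrix.vecMulVec ψ (star ψ)

/-- The configuration which is `a` on the bonds of `Λ` and `c` on the other bonds. -/
def glue (Λ : Finset (Bond L M)) (a : {b // b ∈ Λ} → ZMod d) (c : {b // b ∉ Λ} → ZMod d) :
    Config d L M :=
  fun b => if h : b ∈ Λ then a ⟨b, h⟩ else c ⟨b, h⟩

/-- The reduced density matrix on `Λ`: partial trace over the spins outside `Λ`. -/
noncomputable def reduced (Λ : Finset (Bond L M)) (ρ : Matrix (Config d L M) (Config d L M) ℂ) :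
    Matrix ({b // b ∈ Λ} → ZMod d) ({b // b ∈ Λ} → ZMod d) ℂ :=
  fun a a' => ∑ c : {b // b ∉ Λ} → ZMod d, ρ (glue Λ a c) (glue Λ a' c)

/-- The purity `P_Λ(ρ) = tr ((tr_{Λᶜ} ρ)²)`. -/
noncomputable def purity (Λ : Finset (Bond L M)) (ρ : Matrix (Config d L M) (Config d L M) ℂ) : ℂ :=
  (reduced Λ ρ * reduced Λ ρ).trace

/-- The topological purity `P_AB P_BC / (P_B P_ABC)`. -/
noncomputable def topPurity (A B C : Finset (Bond L M))
    (ρ : Matrix (Config d L M) (Config d L M) ℂ) : ℂ :=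
  purity (A ∪ B) ρ * purity (B ∪ C) ρ / (purity B ρ * purity (A ∪ B ∪ C) ρ)

end Operators

/-! Geometry of regions. A region is a set of spins, that is, of bonds. -/

section Geometry

variable {L M : ℕ}

/-- Two bonds are adjacent if they are distinct and have a common endpoint. -/
def bondGraph (L M : ℕ) : SimpleGraph (Bond L M) where
  Adj b b' := b ≠ b' ∧ ∃ v, Inc v b ∧ Inc v b'
  symm := ⟨fun _ _ h => ⟨h.1.symm, h.2.imp fun _ hv => hv.symm⟩⟩
  loopless := ⟨fun _ h => h.1 rfl⟩

/-- The connected components of a region. -/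
abbrev Comp (S : Set (Bond L M)) : Type := ((bondGraph L M).induce S).ConnectedComponent

/-- The component of the region `S` that contains the bond `b`. -/
def compOf (S : Set (Bond L M)) (b : Bond L M) (h : b ∈ S) : Comp S :=
  ((bondGraph L M).induce S).connectedComponentMk ⟨b, h⟩

/-- The number of connected components of a region. -/
noncomputable def numComp (S : Set (Bond L M)) : ℕ := Nat.card (Comp S)

/-- The two regions have no site in common: no bond of `S` shares an endpoint with (or is equal to)
a bond of `T`. -/
def Apart (S T : Finset (Bond L M)) : Prop :=
  ∀ b ∈ S, ∀ b' ∈ T, ∀ v, ¬ (Inc v b ∧ Inc v b')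

/-- The boundary of `Λ`: the sites that do not lie inside `Λ` (some bond at the site is not in `Λ`)
but are joined to `Λ` (some bond at the site is in `Λ`). -/
def bdry (Λ : Finset (Bond L M)) : Set (Site L M) :=
  {v | (∃ b ∈ Λ, Inc v b) ∧ ∃ b, b ∉ Λ ∧ Inc v b}

/-- `n_i(Λ)`: the number of boundary sites that are joined to `Λ` by exactly `i` bonds. -/
noncomputable def nSites (i : ℕ) (Λ : Finset (Bond L M)) : ℕ :=
  {v ∈ bdry Λ | {b | b ∈ Λ ∧ Inc v b}.ncard = i}.ncard

/-- The number of boundaries `n_∂(Λ)`. A boundary of `Λ` is an interface between a connected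
component of `Λ` and a connected component of the complement of `Λ`, that is, a pair of such
components which meet at a site. -/
noncomputable def numBdry (Λ : Finset (Bond L M)) : ℕ :=
  {q : Comp (Λ : Set (Bond L M)) × Comp ((Λ : Set (Bond L M))ᶜ) |
    ∃ (v : Site L M) (b b' : Bond L M) (h : b ∈ (Λ : Set (Bond L M)))
      (h' : b' ∈ (Λ : Set (Bond L M))ᶜ), Inc v b ∧ Inc v b' ∧
        q = (compOf _ b h, compOf _ b' h')}.ncard

/-- The topological entropy `γ = log₂ d`. -/
noncomputable def topEntropy (d : ℕ) : ℝ := Real.logb 2 d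

/-- The geometrical (shape) correction `γ_Λ = log₂ d · (n₂ + 2 n₃)`. -/
noncomputable def shapeCorr (d : ℕ) (Λ : Finset (Bond L M)) : ℝ :=
  Real.logb 2 d * (nSites 2 Λ + 2 * nSites 3 Λ)

/-- `Λ` lies in a contractible patch of the torus: it avoids all sites of some column and all sites
of some row. -/
def InPatch (Λ : Finset (Bond L M)) : Prop :=
  ∃ a : Site L M, ∀ b ∈ Λ, ∀ v, Inc v b → v.1 ≠ a.1 ∧ v.2 ≠ a.2

/-- The annular configuration: `A` and `C` are kept apart by `B`, the region `ABC` is an annulus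
(connected, with two complementary components), `AB` and `BC` are discs (connected, with connected
complement), and `B` consists of two discs. -/
structure IsAnnular [NeZero L] [NeZero M] (A B C : Finset (Bond L M)) : Prop where
  disjoint_AB : Disjoint A B
  disjoint_BC : Disjoint B C
  apart_AC : Apart A C
  conn_AB : numComp (↑(A ∪ B) : Set (Bond L M)) = 1
  compl_AB : numComp (↑(A ∪ B) : Set (Bond L M))ᶜ = 1
  conn_BC : numComp (↑(B ∪ C) : Set (Bond L M)) = 1
  compl_BC : numComp (↑(B ∪ C) : Set (Bond L M))ᶜ = 1
  conn_B : numComp (↑B : Set (Bond L M)) = 2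
  compl_B : numComp (↑B : Set (Bond L M))ᶜ = 1
  conn_ABC : numComp (↑(A ∪ B ∪ C) : Set (Bond L M)) = 1
  compl_ABC : numComp (↑(A ∪ B ∪ C) : Set (Bond L M))ᶜ = 2

/-- `X` deforms the partition `(A, B, C)` locally into `(A', B', C')`: the set `X` is joined to `A`
and stays away from `C`, or it is joined to `C` and stays away from `A`, or it is joined to `B`,
stays away from `A` and `C`, and does not touch two different components of `B`. -/
inductive LocalDeformation (A B C X : Finset (Bond L M)) :
    Finset (Bond L M) → Finset (Bond L M) → Finset (Bond L M) → Prop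
  | joinA (h : Apart X C) : LocalDeformation A B C X (A ∪ X) B C
  | joinC (h : Apart X A) : LocalDeformation A B C X A B (C ∪ X)
  | joinB (hA : Apart X A) (hC : Apart X C)
      (hB : ∀ (b b' : Bond L M) (hb : b ∈ (B : Set (Bond L M))) (hb' : b' ∈ (B : Set (Bond L M))),
        ¬ Apart X {b} → ¬ Apart X {b'} → compOf _ b hb = compOf _ b' hb') :
      LocalDeformation A B C X A (B ∪ X) C

end Geometry

end QuantumDouble

/-! The proof reduces everything to counting components. A ground state is supported on flat
configurations (zero oriented sum around each plaquette) and is invariant under adding lattice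
gradients, because the star operator `A_m(v)` is translation by the gradient of `m` times a delta at
`v`. In a contractible patch flatness means being a gradient, so the reduced density matrix on `Λ`
is a constant multiple of the indicator of `a ∈ R`, `a' - a ∈ G`, where `R` consists of the
gradients restricted to `Λ` and `G ≤ R` of those vanishing outside `Λ` (`reduced_apply`). With trace
one this gives purity `|G| / |R|`. Both orders follow from counting locally constant functions on
sites (`card_locConst`), and the result is `purity_mul_pow`: the purity is `d` to the power `c(Λ) +
c(Λᶜ) - |∂Λ| - 1`, with `c` the number of components.

Since `A` and `C` share no site, every quantity determined site by site cancels in the ratio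
(`ncard_add_ncard_eq`): boundary lengths and shape corrections alike. Only the component totals
remain. They are 2 for `AB` and `BC` and 3 for `B` and `ABC`, whence `d⁻²`.

It remains to see that a deformation preserves this balance (`LocalDeformation.balance`). Let `W =
ABCX`. The bipartite graph formed by the components of `W` and of `Wᶜ`, with the boundaries as
edges, is connected, so `c(W) + c(Wᶜ) ≤ n_∂(W) + 1`. The right side is at most 3, as `n_∂` is that
of an annulus. If `X` avoids `C`, neither component of the complement of `ABC` can be swallowed by
`X`, because each of them touches `C`; hence `c(Wᶜ) ≥ 2`, and the bound forces `c(W) = 1`, `c(Wᶜ) =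
2`. The remaining regions inherit their connectedness from this (`IsAnnular.attach`,
`IsAnnular.attach_middle`). -/

namespace QuantumDouble

/-! ### Connectedness of regions of bonds -/

section Topology

variable {L M : ℕ}

/-- Two bonds touch if they share an endpoint. -/
def Touch (b b' : Bond L M) : Prop := ∃ v, Inc v b ∧ Inc v b'

lemma Touch.symm {b b' : Bond L M} (h : Touch b b') : Touch b' b :=
  h.imp fun _ hv => hv.symm

lemma apart_iff {S T : Finset (Bond L M)} :
    Apart S T ↔ ∀ b ∈ S, ∀ b' ∈ T, ¬ Touch b b' := by
  simp [Apart, Touch]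

lemma Touch.refl (b : Bond L M) : Touch b b := ⟨tail b, Or.inl rfl, Or.inl rfl⟩

lemma compOf_eq_of_touch {S : Set (Bond L M)} {b b' : Bond L M} (hb : b ∈ S) (hb' : b' ∈ S)
    (h : Touch b b') : compOf S b hb = compOf S b' hb' := by
  by_cases hbb : b = b'
  · subst hbb; rfl
  · apply SimpleGraph.ConnectedComponent.sound
    apply SimpleGraph.Adj.reachable
    exact ⟨hbb, h⟩

/-- Induction along a walk. This is the tool for telling components apart: exhibit a label that does
not change between touching bonds. -/
lemma eq_of_compOf_eq {S : Set (Bond L M)} {α : Type*} (f : Bond L M → α)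
    (hf : ∀ b ∈ S, ∀ b' ∈ S, Touch b b' → f b = f b') {b b' : Bond L M} (hb : b ∈ S)
    (hb' : b' ∈ S) (h : compOf S b hb = compOf S b' hb') : f b = f b' := by
  have key : ∀ x y : S, ((bondGraph L M).induce S).Reachable x y → f x = f y := by
    rintro x y ⟨w⟩
    induction w with
    | nil => rfl
    | cons hadj _ ih => exact (hf _ (Subtype.prop _) _ (Subtype.prop _) hadj.2).trans ih
  exact key ⟨b, hb⟩ ⟨b', hb'⟩ (SimpleGraph.ConnectedComponent.exact h)

lemma exists_compOf_eq {S : Set (Bond L M)} (K : Comp S) : ∃ b, ∃ h : b ∈ S, compOf S b h = K := by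
  induction K using SimpleGraph.ConnectedComponent.ind with
  | h v => exact ⟨v, v.2, rfl⟩

/-- Every property that spreads along touching bonds of `S` holds on all of `S` or nowhere. -/
def Linked (S : Set (Bond L M)) : Prop :=
  ∀ P : Bond L M → Prop, (∀ b ∈ S, ∀ b' ∈ S, Touch b b' → P b → P b') →
    ∀ b ∈ S, ∀ b' ∈ S, P b → P b'

/-- The invariant formulation `Linked` replaces walks by a choice of predicate; for the converse the
predicate is membership in the component of a fixed bond. -/
lemma numComp_eq_one_iff {S : Set (Bond L M)} : numComp S = 1 ↔ S.Nonempty ∧ Linked S := by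
  rw [numComp, Nat.card_eq_one_iff_unique]
  constructor
  · rintro ⟨hs, ⟨K⟩⟩
    obtain ⟨b, hb, -⟩ := exists_compOf_eq K
    refine ⟨⟨b, hb⟩, fun P hP b hb b' hb' h => ?_⟩
    rwa [← eq_of_compOf_eq P (fun x hx y hy hxy => propext
      ⟨hP x hx y hy hxy, hP y hy x hx hxy.symm⟩) hb hb' (hs.elim _ _)]
  · rintro ⟨⟨b, hb⟩, hl⟩
    refine ⟨⟨fun K K' => ?_⟩, ⟨compOf S b hb⟩⟩
    obtain ⟨x, hx, rfl⟩ := exists_compOf_eq K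
    obtain ⟨y, hy, rfl⟩ := exists_compOf_eq K'
    obtain ⟨_, h⟩ := hl (fun z => ∃ hz : z ∈ S, compOf S x hx = compOf S z hz)
      (fun u hu w hw huw ⟨_, h⟩ => ⟨hw, h.trans (compOf_eq_of_touch hu hw huw)⟩) x hx y hy
      ⟨hx, rfl⟩
    exact h

lemma Linked.union {S T : Set (Bond L M)} (hS : Linked S) (hT : Linked T)
    (h : (S ∩ T).Nonempty) : Linked (S ∪ T) := by
  obtain ⟨c, hcS, hcT⟩ := h
  intro P hP b hb b' hb' hPb
  have h1 := hS P fun x hx y hy => hP x (Or.inl hx) y (Or.inl hy)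
  have h2 := hT P fun x hx y hy => hP x (Or.inr hx) y (Or.inr hy)
  have hc : P c := hb.elim (fun hb => h1 _ hb _ hcS hPb) fun hb => h2 _ hb _ hcT hPb
  exact hb'.elim (fun hb' => h1 _ hcS _ hb' hc) fun hb' => h2 _ hcT _ hb' hc

/-- A connected region stays connected after attaching `X` if the rest of a connected region that
contains both does not touch `X`. -/
lemma Linked.union_of_apart {Y X Z : Set (Bond L M)} (hW : Linked (Y ∪ X ∪ Z)) (hY : Linked Y)
    (hne : Y.Nonempty) (hXZ : ∀ b ∈ X, ∀ b' ∈ Z, ¬ Touch b b') : Linked (Y ∪ X) := by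
  obtain ⟨y, hy⟩ := hne
  intro P hP
  have hYP := hY P fun x hx z hz => hP x (Or.inl hx) z (Or.inl hz)
  have key : ∀ b ∈ Y ∪ X, P b ↔ P y := by
    -- Extend `P` to `Z` by the constant value `P y`. The extension still spreads, since `Z` is
    -- entered and left only through `Y`, where `P` is already constant.
    have aux := hW (fun b => (b ∈ Y ∪ X ∧ P b) ∨ (b ∉ Y ∪ X ∧ P y)) (by
      intro b hb b' hb' ht h
      by_cases h1 : b ∈ Y ∪ X <;> by_cases h2 : b' ∈ Y ∪ X
      · left; exact ⟨h2, hP b h1 b' h2 ht (by tauto)⟩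
      · right
        have hZ : b' ∈ Z := hb'.resolve_left h2
        have hbY : b ∈ Y := h1.resolve_right fun hX => hXZ b hX b' hZ ht
        exact ⟨h2, hYP b hbY y hy (by tauto)⟩
      · left
        have hZ : b ∈ Z := hb.resolve_left h1
        have hbY : b' ∈ Y := h2.resolve_right fun hX => hXZ b' hX b hZ ht.symm
        exact ⟨h2, hYP y hy b' hbY (by tauto)⟩
      · right; tauto)
    intro b hb
    constructor
    · intro h
      have := aux b (Or.inl hb) y (Or.inl (Or.inl hy)) (Or.inl ⟨hb, h⟩)
      have hy' : y ∈ Y ∪ X := Or.inl hy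
      tauto
    · intro h
      have := aux y (Or.inl (Or.inl hy)) b (Or.inl hb) (Or.inl ⟨Or.inl hy, h⟩)
      tauto
  intro b hb b' hb' h
  exact (key b' hb').2 ((key b hb).1 h)

/-- Removing `X` from two regions `D₁`, `D₂` joined through `C` leaves a connected region if
`X` does not touch `C` and does not disconnect `D₁`, `D₂`. -/
lemma Linked.diff_of_apart {C D₁ D₂ X : Set (Bond L M)} (h : Linked (C ∪ (D₁ ∪ D₂)))
    (h₁ : Linked (D₁ \ X)) (h₂ : Linked (D₂ \ X)) (n₁ : (D₁ \ X).Nonempty)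
    (n₂ : (D₂ \ X).Nonempty) (hCD : Disjoint C (D₁ ∪ D₂))
    (hD : ∀ b ∈ D₁, ∀ b' ∈ D₂, ¬ Touch b b') (hXC : ∀ b ∈ X, ∀ b' ∈ C, ¬ Touch b b') :
    Linked (C ∪ (D₁ ∪ D₂) \ X) := by
  obtain ⟨d₁, hd₁⟩ := n₁
  obtain ⟨d₂, hd₂⟩ := n₂
  intro P hP
  have hC1 : ∀ b ∈ C, b ∉ D₁ := fun b hb hb' => Set.disjoint_left.1 hCD hb (Or.inl hb')
  have hC2 : ∀ b ∈ C, b ∉ D₂ := fun b hb hb' => Set.disjoint_left.1 hCD hb (Or.inr hb')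
  have hD12 : ∀ b ∈ D₁, b ∉ D₂ := fun b hb hb' => hD b hb b hb' (Touch.refl b)
  have m1 : ∀ b ∈ D₁ \ X, b ∈ C ∪ (D₁ ∪ D₂) \ X := fun b hb => Or.inr ⟨Or.inl hb.1, hb.2⟩
  have m2 : ∀ b ∈ D₂ \ X, b ∈ C ∪ (D₁ ∪ D₂) \ X := fun b hb => Or.inr ⟨Or.inr hb.1, hb.2⟩
  have h1P := h₁ P fun x hx z hz => hP x (m1 x hx) z (m1 z hz)
  have h2P := h₂ P fun x hx z hz => hP x (m2 x hx) z (m2 z hz)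
  -- `Q` fills the removed set `X` back in: on each `Dᵢ` it takes the constant value that `P` has on
  -- `Dᵢ \ X`.
  set Q : Bond L M → Prop := fun b => (b ∈ C ∧ P b) ∨ (b ∈ D₁ ∧ P d₁) ∨ (b ∈ D₂ ∧ P d₂) with hQ
  have QC : ∀ b ∈ C, (Q b ↔ P b) := fun b hb => by
    have := hC1 b hb; have := hC2 b hb; simp only [hQ]; tauto
  have Q1 : ∀ b ∈ D₁, (Q b ↔ P d₁) := fun b hb => by
    have := hD12 b hb; have := fun h => hC1 b h hb; simp only [hQ]; tauto
  have Q2 : ∀ b ∈ D₂, (Q b ↔ P d₂) := fun b hb => by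
    have := fun h => hD12 b h hb; have := fun h => hC2 b h hb; simp only [hQ]; tauto
  have QP : ∀ b ∈ C ∪ (D₁ ∪ D₂) \ X, (Q b ↔ P b) := by
    rintro b (hb | ⟨hb | hb, hbX⟩)
    · exact QC b hb
    · rw [Q1 b hb]
      exact ⟨h1P _ hd₁ _ ⟨hb, hbX⟩, h1P _ ⟨hb, hbX⟩ _ hd₁⟩
    · rw [Q2 b hb]
      exact ⟨h2P _ hd₂ _ ⟨hb, hbX⟩, h2P _ ⟨hb, hbX⟩ _ hd₂⟩
  have QQ := h Q (by
    intro b hb b' hb' ht hq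
    by_cases hin : b ∈ C ∪ (D₁ ∪ D₂) \ X ∧ b' ∈ C ∪ (D₁ ∪ D₂) \ X
    · rw [QP _ hin.1] at hq
      rw [QP _ hin.2]
      exact hP _ hin.1 _ hin.2 ht hq
    -- If one of the two bonds lies in `X`, neither lies in `C`; both are then in the same `Dᵢ`,
    -- where `Q` is constant.
    have hnC : b ∉ C ∧ b' ∉ C := by
      constructor
      · intro hbC
        refine hin ⟨Or.inl hbC, hb'.imp_right fun h => ⟨h, fun hX => hXC _ hX _ hbC ht.symm⟩⟩
      · intro hbC
        refine hin ⟨hb.imp_right fun h => ⟨h, fun hX => hXC _ hX _ hbC ht⟩, Or.inl hbC⟩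
    rcases hb.resolve_left hnC.1 with hb | hb <;> rcases hb'.resolve_left hnC.2 with hb' | hb'
    · rw [Q1 b hb] at hq; rwa [Q1 b' hb']
    · exact absurd ht (hD b hb b' hb')
    · exact absurd ht.symm (hD b' hb' b hb)
    · rw [Q2 b hb] at hq; rwa [Q2 b' hb'])
  have hsub : C ∪ (D₁ ∪ D₂) \ X ⊆ C ∪ (D₁ ∪ D₂) := by
    intro b; simp only [Set.mem_union, Set.mem_sdiff]; tauto
  intro b hb b' hb' hp
  rw [← QP b' hb']
  exact QQ b (hsub hb) b' (hsub hb') ((QP b hb).2 hp)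

/-! Additivity of the number of components. -/

lemma zmod_induction {n : ℕ} [NeZero n] {P : ZMod n → Prop} (h0 : P 0)
    (hs : ∀ x, P x → P (x + 1)) (x : ZMod n) : P x := by
  have : ∀ k : ℕ, P (k : ZMod n) := by
    intro k
    induction k with
    | zero => simpa using h0
    | succ k ih => simpa using hs _ ih
  simpa using this x.val

/-- A label recording the component within `S`, and `none` off `S`; it shows that forming the union
with a separated `T` merges no components of `S`. -/
lemma touch_const_dite {S T : Set (Bond L M)} (h : ∀ b ∈ S, ∀ b' ∈ T, ¬ Touch b b')
    [DecidablePred (· ∈ S)] :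
    ∀ b ∈ S ∪ T, ∀ b' ∈ S ∪ T, Touch b b' →
      (if hb : b ∈ S then some (compOf S b hb) else none) =
        if hb : b' ∈ S then some (compOf S b' hb) else none := by
  intro b hb b' hb' ht
  by_cases h1 : b ∈ S <;> by_cases h2 : b' ∈ S
  · simp only [h1, h2, dite_true, compOf_eq_of_touch h1 h2 ht]
  · exact absurd ht (h b h1 b' (hb'.resolve_left h2))
  · exact absurd ht.symm (h b' h2 b (hb.resolve_left h1))
  · simp [h1, h2]

lemma Apart.symm {S T : Finset (Bond L M)} (h : Apart S T) : Apart T S :=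
  fun b hb b' hb' v hv => h b' hb' b hb v hv.symm

variable [NeZero L] [NeZero M]

lemma numComp_pos {S : Set (Bond L M)} (h : S.Nonempty) : 0 < numComp S := by
  obtain ⟨b, hb⟩ := h
  have : Nonempty (Comp S) := ⟨compOf S b hb⟩
  exact Nat.card_pos

lemma numComp_union {S T : Set (Bond L M)} (h : ∀ b ∈ S, ∀ b' ∈ T, ¬ Touch b b') :
    numComp (S ∪ T) = numComp S + numComp T := by
  classical
  unfold numComp
  rw [← Nat.card_sum]
  symm
  let F : Comp S ⊕ Comp T → Comp (S ∪ T) := Sum.elim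
    (SimpleGraph.ConnectedComponent.map
      (SimpleGraph.induceHomOfLE (bondGraph L M) (Set.subset_union_left (s := S) (t := T))).toHom)
    (SimpleGraph.ConnectedComponent.map
      (SimpleGraph.induceHomOfLE (bondGraph L M) (Set.subset_union_right (s := S) (t := T))).toHom)
  have Fl : ∀ b (hb : b ∈ S), F (Sum.inl (compOf S b hb)) = compOf (S ∪ T) b (Or.inl hb) :=
    fun _ _ => rfl
  have Fr : ∀ b (hb : b ∈ T), F (Sum.inr (compOf T b hb)) = compOf (S ∪ T) b (Or.inr hb) :=
    fun _ _ => rfl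
  have h' : ∀ b ∈ T, ∀ b' ∈ S, ¬ Touch b b' := fun b hb b' hb' ht => h b' hb' b hb ht.symm
  have cS := touch_const_dite h
  have cT := touch_const_dite h'
  rw [Set.union_comm] at cT
  refine Nat.card_eq_of_bijective F ⟨?_, ?_⟩
  · rintro (K | K) (K' | K') hK <;> obtain ⟨b, hb, rfl⟩ := exists_compOf_eq K <;>
      obtain ⟨b', hb', rfl⟩ := exists_compOf_eq K' <;> simp only [Fl, Fr] at hK
    · have := eq_of_compOf_eq _ cS _ _ hK
      simpa [hb, hb'] using this
    · have := eq_of_compOf_eq _ cS _ _ hK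
      have hn : b' ∉ S := fun hS => h b' hS b' hb' (Touch.refl _)
      simp [hb, hn] at this
    · have := eq_of_compOf_eq _ cS _ _ hK
      have hn : b ∉ S := fun hS => h b hS b hb (Touch.refl _)
      simp [hb', hn] at this
    · have := eq_of_compOf_eq _ cT _ _ hK
      simpa [hb, hb'] using this
  · intro K
    obtain ⟨b, hb, rfl⟩ := exists_compOf_eq K
    rcases hb with hb | hb
    · exact ⟨_, Fl b hb⟩
    · exact ⟨_, Fr b hb⟩

lemma exists_split_of_numComp_eq_two {S : Set (Bond L M)} (h : numComp S = 2) :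
    ∃ S₁ S₂, S₁ ∪ S₂ = S ∧ (∀ b ∈ S₁, ∀ b' ∈ S₂, ¬ Touch b b') ∧
      numComp S₁ = 1 ∧ numComp S₂ = 1 := by
  obtain ⟨K, K', hne, -⟩ := Nat.card_eq_two_iff.1 h
  obtain ⟨b, hb, rfl⟩ := exists_compOf_eq K
  obtain ⟨b', hb', rfl⟩ := exists_compOf_eq K'
  let S₁ : Set (Bond L M) := {x | ∃ hx : x ∈ S, compOf S x hx = compOf S b hb}
  have hsub : S₁ ⊆ S := fun x hx => hx.1
  have ht : ∀ x ∈ S₁, ∀ y ∈ S \ S₁, ¬ Touch x y := by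
    rintro x ⟨hx, hxb⟩ y ⟨hy, hny⟩ hxy
    exact hny ⟨hy, (compOf_eq_of_touch hx hy hxy).symm.trans hxb⟩
  have hu : S₁ ∪ (S \ S₁) = S := Set.union_sdiff_cancel hsub
  have h1 : 0 < numComp S₁ := numComp_pos ⟨b, hb, rfl⟩
  have h2 : 0 < numComp (S \ S₁) := numComp_pos ⟨b', hb', fun ⟨_, hh⟩ => hne hh.symm⟩
  have := numComp_union ht
  rw [hu, h] at this
  exact ⟨S₁, S \ S₁, hu, ht, by omega, by omega⟩

/-! ### Components versus boundaries -/

lemma linked_univ : Linked (Set.univ : Set (Bond L M)) := by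
  intro P hP b _ b' _ hb
  have hP' : ∀ b b', Touch b b' → P b → P b' := fun b b' => hP b trivial b' trivial
  have ht : ∀ (v : Site L M) s s', P (v, s) → P (v, s') := fun v s s' =>
    hP' _ _ ⟨v, Or.inl rfl, Or.inl rfl⟩
  have hr : ∀ (v : Site L M) s, P (v, s) → P (right v, s) := fun v s h =>
    ht _ false _ (hP' _ _ ⟨right v, Or.inr rfl, Or.inl rfl⟩ (ht v s false h))
  have hu : ∀ (v : Site L M) s, P (v, s) → P (up v, s) := fun v s h =>
    ht _ true _ (hP' _ _ ⟨up v, Or.inr rfl, Or.inl rfl⟩ (ht v s true h))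
  obtain ⟨⟨x, y⟩, s⟩ := b
  obtain ⟨⟨x', y'⟩, s'⟩ := b'
  have h1 : ∀ z : ZMod L, P ((x + z, y), s) := zmod_induction (by simpa using hb)
    fun z hz => by simpa [right, add_assoc] using hr _ _ hz
  have h2 : ∀ w : ZMod M, P ((x', y + w), s) := zmod_induction (by simpa using h1 (x' - x))
    fun z hz => by simpa [up, add_assoc] using hu _ _ hz
  exact ht _ s _ (by simpa using h2 (y' - y))

/-- The graph of components of a region and of its complement is connected, so it has at most one
vertex more than edges. -/
lemma numComp_add_numComp_compl_le (Λ : Finset (Bond L M)) :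
    numComp (Λ : Set (Bond L M)) + numComp (Λ : Set (Bond L M))ᶜ ≤ numBdry Λ + 1 := by
  classical
  set S : Set (Bond L M) := (Λ : Set (Bond L M)) with hS
  set E : Set (Comp S × Comp Sᶜ) := {q | ∃ (v : Site L M) (b b' : Bond L M) (h : b ∈ S)
      (h' : b' ∈ Sᶜ), Inc v b ∧ Inc v b' ∧ q = (compOf _ b h, compOf _ b' h')} with hE
  let G : SimpleGraph (Comp S ⊕ Comp Sᶜ) :=
    SimpleGraph.fromEdgeSet ((fun q : Comp S × Comp Sᶜ => s(Sum.inl q.1, Sum.inr q.2)) '' E)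
  let f : Bond L M → Comp S ⊕ Comp Sᶜ := fun b =>
    if h : b ∈ S then Sum.inl (compOf S b h) else Sum.inr (compOf Sᶜ b h)
  have hadj : ∀ b ∈ S, ∀ b' ∈ Sᶜ, Touch b b' → G.Adj (f b) (f b') := by
    rintro b hb b' hb' ⟨v, hv, hv'⟩
    have h' : b' ∉ S := hb'
    have e1 : f b = Sum.inl (compOf S b hb) := dif_pos hb
    have e2 : f b' = Sum.inr (compOf Sᶜ b' hb') := dif_neg h'
    rw [e1, e2]
    simp only [G, SimpleGraph.fromEdgeSet_adj]
    exact ⟨⟨_, ⟨v, b, b', hb, hb', hv, hv', rfl⟩, rfl⟩, by simp⟩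
  have hreach : ∀ b b', Touch b b' → G.Reachable (f b) (f b') := by
    intro b b' ht
    by_cases h1 : b ∈ S <;> by_cases h2 : b' ∈ S
    · simp only [f, h1, h2, dite_true, compOf_eq_of_touch h1 h2 ht]; rfl
    · exact (hadj b h1 b' h2 ht).reachable
    · exact (hadj b' h2 b h1 ht.symm).reachable.symm
    · simp only [f, h1, h2, dite_false, compOf_eq_of_touch (S := Sᶜ) h1 h2 ht]; rfl
  have hsurj : ∀ x, ∃ b, f b = x := by
    rintro (K | K) <;> obtain ⟨b, hb, rfl⟩ := exists_compOf_eq K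
    · exact ⟨b, dif_pos hb⟩
    · exact ⟨b, dif_neg hb⟩
  have hconn : G.Connected := by
    have : Nonempty (Comp S ⊕ Comp Sᶜ) := ⟨f ((0, 0), false)⟩
    refine ⟨fun x y => ?_⟩
    obtain ⟨b, rfl⟩ := hsurj x
    obtain ⟨b', rfl⟩ := hsurj y
    exact linked_univ (fun c => G.Reachable (f b) (f c))
      (fun c _ c' _ ht hc => hc.trans (hreach c c' ht)) b trivial b' trivial
      (SimpleGraph.Reachable.refl _)
  have h1 := hconn.card_vert_le_card_edgeSet_add_one
  -- Only an upper bound on the edges is needed, so the map from boundaries to edges need not be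
  -- shown injective.
  have h2 : Nat.card G.edgeSet ≤ E.ncard := by
    rw [Nat.card_coe_set_eq]
    refine (Set.ncard_le_ncard ?_ (Set.toFinite _)).trans (Set.ncard_image_le (Set.toFinite E)
      (f := fun q : Comp S × Comp Sᶜ => s(Sum.inl q.1, Sum.inr q.2)))
    simp only [G, SimpleGraph.edgeSet_fromEdgeSet]
    exact Set.sdiff_subset
  rw [Nat.card_sum] at h1
  exact h1.trans (Nat.add_le_add_right h2 1)

lemma numBdry_le (Λ : Finset (Bond L M)) :
    numBdry Λ ≤ numComp (Λ : Set (Bond L M)) * numComp (Λ : Set (Bond L M))ᶜ := by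
  unfold numBdry numComp
  rw [← Nat.card_prod]
  exact Set.ncard_le_card _

/-! ### Annular configurations under attaching a set -/

lemma IsAnnular.symm {A B C : Finset (Bond L M)} (h : IsAnnular A B C) : IsAnnular C B A where
  disjoint_AB := h.disjoint_BC.symm
  disjoint_BC := h.disjoint_AB.symm
  apart_AC := h.apart_AC.symm
  conn_AB := by rw [Finset.union_comm]; exact h.conn_BC
  compl_AB := by rw [Finset.union_comm]; exact h.compl_BC
  conn_BC := by rw [Finset.union_comm]; exact h.conn_AB
  compl_BC := by rw [Finset.union_comm]; exact h.compl_AB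
  conn_B := h.conn_B
  compl_B := h.compl_B
  conn_ABC := by
    rw [Finset.union_comm, ← Finset.union_assoc, Finset.union_right_comm]; exact h.conn_ABC
  compl_ABC := by
    rw [Finset.union_comm, ← Finset.union_assoc, Finset.union_right_comm]; exact h.compl_ABC

/-- Attaching `X` away from `C` without changing the number of boundaries of an annulus keeps `ABC`
an annulus and `AB` a disc. -/
lemma IsAnnular.attach {A B C X : Finset (Bond L M)} (h : IsAnnular A B C) (hX : Apart X C)
    (hb : numBdry (A ∪ B ∪ C ∪ X) = numBdry (A ∪ B ∪ C)) :
    numComp (↑(A ∪ B ∪ X) : Set (Bond L M)) = 1 ∧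
      numComp (↑(A ∪ B ∪ X) : Set (Bond L M))ᶜ = 1 ∧
      numComp (↑(A ∪ B ∪ C ∪ X) : Set (Bond L M)) = 1 ∧
      numComp (↑(A ∪ B ∪ C ∪ X) : Set (Bond L M))ᶜ = 2 := by
  have hXC := apart_iff.1 hX
  have hAC := apart_iff.1 h.apart_AC
  obtain ⟨D₁, D₂, hD, hDD, hD1, hD2⟩ := exists_split_of_numComp_eq_two h.compl_ABC
  have hmem : ∀ b, b ∈ D₁ ∨ b ∈ D₂ ↔ b ∉ A ∧ b ∉ B ∧ b ∉ C := by
    intro b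
    have := Set.ext_iff.1 hD b
    simpa [not_or] using this
  have hCdis : ∀ b ∈ C, b ∉ A ∧ b ∉ B := fun b hb =>
    ⟨fun hA => hAC b hA b hb (Touch.refl b), fun hB => Finset.disjoint_left.1 h.disjoint_BC hB hb⟩
  have hABc : (↑(A ∪ B) : Set (Bond L M))ᶜ = ↑C ∪ (D₁ ∪ D₂) := by
    ext b
    have := hmem b; have := hCdis b
    simp only [Finset.coe_union, Set.mem_compl_iff, Set.mem_union, SetLike.mem_coe]
    tauto
  have hLAB : Linked ((↑C : Set (Bond L M)) ∪ (D₁ ∪ D₂)) := by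
    rw [← hABc]; exact (numComp_eq_one_iff.1 h.compl_AB).2
  obtain ⟨n₁, -⟩ := numComp_eq_one_iff.1 hD1
  obtain ⟨n₂, -⟩ := numComp_eq_one_iff.1 hD2
  -- A part `E` of the complement that did not touch `C` would be cut off from `F`, although `C ∪ E
  -- ∪ F`, the complement of the disc `AB`, is connected.
  have touch_C : ∀ E F : Set (Bond L M), E.Nonempty → F.Nonempty →
      (∀ b ∈ E, ∀ b' ∈ F, ¬ Touch b b') → Linked ((↑C : Set (Bond L M)) ∪ (E ∪ F)) →
      ∃ b ∈ E, ∃ c ∈ C, Touch b c := by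
    rintro E F ⟨e, he⟩ ⟨f, hf⟩ hEF hl
    by_contra! hcon
    have := hl (· ∈ E) (by
      rintro b - b' (hb' | hb' | hb') ht hb
      · exact absurd ht (hcon b hb b' hb')
      · exact hb'
      · exact absurd ht (hEF b hb b' hb')) e (by simp [he]) f (by simp [hf]) he
    exact hEF f this f hf (Touch.refl f)
  have m₁ : (D₁ \ ↑X).Nonempty := by
    obtain ⟨b, hb, c, hc, ht⟩ := touch_C D₁ D₂ n₁ n₂ hDD hLAB
    exact ⟨b, hb, fun hx => hXC b hx c hc ht⟩
  have m₂ : (D₂ \ ↑X).Nonempty := by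
    obtain ⟨b, hb, c, hc, ht⟩ := touch_C D₂ D₁ n₂ n₁ (fun b hb b' hb' ht => hDD b' hb' b hb ht.symm)
      (by rwa [Set.union_comm D₂])
    exact ⟨b, hb, fun hx => hXC b hx c hc ht⟩
  have hWc : (↑(A ∪ B ∪ C ∪ X) : Set (Bond L M))ᶜ = (D₁ \ ↑X) ∪ (D₂ \ ↑X) := by
    ext b
    have := hmem b
    simp only [Finset.coe_union, Set.mem_compl_iff, Set.mem_union, SetLike.mem_coe, Set.mem_sdiff]
    tauto
  have hadd := numComp_union (S := D₁ \ ↑X) (T := D₂ \ ↑X)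
    fun b hb b' hb' => hDD b hb.1 b' hb'.1
  rw [← hWc] at hadd
  have p₁ := numComp_pos m₁
  have p₂ := numComp_pos m₂
  have hle := numComp_add_numComp_compl_le (A ∪ B ∪ C ∪ X)
  have hle2 := numBdry_le (A ∪ B ∪ C)
  rw [h.conn_ABC, h.compl_ABC, ← hb] at hle2
  obtain ⟨nAB, lAB⟩ := numComp_eq_one_iff.1 h.conn_AB
  have p₃ : 0 < numComp (↑(A ∪ B ∪ C ∪ X) : Set (Bond L M)) :=
    numComp_pos (nAB.mono (by intro b; simp only [Finset.coe_union, Set.mem_union]; tauto))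
  -- Squeeze: at least one component inside and two outside, at most three in total. The same count
  -- makes each `Dᵢ \ X` connected.
  have w1 : numComp (↑(A ∪ B ∪ C ∪ X) : Set (Bond L M)) = 1 := by omega
  refine ⟨?_, ?_, w1, by omega⟩
  · rw [numComp_eq_one_iff]
    rw [Finset.coe_union]
    refine ⟨nAB.mono Set.subset_union_left, Linked.union_of_apart (Z := ↑C) ?_ lAB nAB hXC⟩
    have := (numComp_eq_one_iff.1 w1).2
    rw [Finset.union_right_comm] at this
    simpa only [Finset.coe_union] using this
  · have : (↑(A ∪ B ∪ X) : Set (Bond L M))ᶜ = ↑C ∪ (D₁ ∪ D₂) \ ↑X := by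
      ext b
      have := hmem b; have := hCdis b; have := fun hx hc => hXC b hx b hc (Touch.refl b)
      simp only [Finset.coe_union, Set.mem_compl_iff, Set.mem_union, SetLike.mem_coe, Set.mem_sdiff]
      tauto
    rw [this, numComp_eq_one_iff]
    refine ⟨?_, Linked.diff_of_apart hLAB (numComp_eq_one_iff.1 (by omega)).2
      (numComp_eq_one_iff.1 (by omega)).2 m₁ m₂ ?_ hDD hXC⟩
    · obtain ⟨b, hb⟩ := m₁
      exact ⟨b, Or.inr ⟨Or.inl hb.1, hb.2⟩⟩
    · rw [Set.disjoint_left]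
      intro b hbC hbD
      exact ((hmem b).1 hbD).2.2 hbC

/-- Attaching `X` to one component of `B`, away from `A` and `C`, keeps the two components of `B`
and its connected complement. -/
lemma IsAnnular.attach_middle {A B C X : Finset (Bond L M)} (h : IsAnnular A B C)
    (hXA : Apart X A) (hXC : Apart X C)
    (hB : ∀ (b b' : Bond L M) (hb : b ∈ (B : Set (Bond L M))) (hb' : b' ∈ (B : Set (Bond L M))),
        ¬ Apart X {b} → ¬ Apart X {b'} → compOf _ b hb = compOf _ b' hb')
    (hb : numBdry (A ∪ B ∪ C ∪ X) = numBdry (A ∪ B ∪ C)) :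
    numComp (↑(B ∪ X) : Set (Bond L M)) = 2 ∧ numComp (↑(B ∪ X) : Set (Bond L M))ᶜ = 1 := by
  obtain ⟨-, c1, w1, w2⟩ := h.attach hXC hb
  have hsw : C ∪ B ∪ A = A ∪ B ∪ C := by
    ext b; simp only [Finset.mem_union]; tauto
  obtain ⟨-, c2, -, -⟩ := h.symm.attach hXA (by rw [hsw]; exact hb)
  have hXA' := apart_iff.1 hXA
  have hXC' := apart_iff.1 hXC
  have hAC := apart_iff.1 h.apart_AC
  constructor
  · obtain ⟨B₁, B₂, hBB, hB12, h1, h2⟩ := exists_split_of_numComp_eq_two h.conn_B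
    have attach : ∀ E F : Set (Bond L M), E ∪ F = ↑B → (∀ b ∈ E, ∀ b' ∈ F, ¬ Touch b b') →
        numComp E = 1 → numComp F = 1 → (∀ b ∈ (X : Set (Bond L M)), ∀ b' ∈ F, ¬ Touch b b') →
        numComp (↑(B ∪ X) : Set (Bond L M)) = 2 := by
      intro E F hEF hn hE hF hXF
      obtain ⟨nE, lE⟩ := numComp_eq_one_iff.1 hE
      have : (↑(B ∪ X) : Set (Bond L M)) = (E ∪ ↑X) ∪ F := by
        rw [Finset.coe_union, ← hEF, Set.union_right_comm]
      rw [this, numComp_union (by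
        rintro b (hb | hb) b' hb'
        · exact hn b hb b' hb'
        · exact hXF b hb b' hb'), hF]
      suffices numComp (E ∪ (X : Set (Bond L M))) = 1 by omega
      -- Inside the connected `ABCX`, the set `X` can touch only itself and `E`, so it must hang on
      -- `E`.
      refine numComp_eq_one_iff.2 ⟨nE.mono Set.subset_union_left,
        Linked.union_of_apart (Z := F ∪ (↑A ∪ ↑C)) ?_ lE nE ?_⟩
      · convert (numComp_eq_one_iff.1 w1).2 using 1
        simp only [Finset.coe_union, ← hEF]
        ext b
        simp only [Set.mem_union]
        tauto
      · rintro b hb b' (hb' | hb' | hb')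
        · exact hXF b hb b' hb'
        · exact hXA' b hb b' hb'
        · exact hXC' b hb b' hb'
    by_cases hx : ∀ b ∈ (X : Set (Bond L M)), ∀ b' ∈ B₂, ¬ Touch b b'
    · exact attach B₁ B₂ hBB hB12 h1 h2 hx
    · refine attach B₂ B₁ (by rwa [Set.union_comm]) (fun b hb b' hb' ht => hB12 b' hb' b hb ht.symm)
        h2 h1 fun x hxX b hbB ht => ?_
      push Not at hx
      obtain ⟨x', hxX', b', hbB', ht'⟩ := hx
      have hbm : b ∈ (B : Set (Bond L M)) := hBB ▸ Or.inl hbB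
      have hbm' : b' ∈ (B : Set (Bond L M)) := hBB ▸ Or.inr hbB'
      have heq := hB b b' hbm hbm' (fun hap => apart_iff.1 hap x hxX b (by simp) ht)
        (fun hap => apart_iff.1 hap x' hxX' b' (by simp) ht')
      have := eq_of_compOf_eq (· ∈ B₁) (by
        rw [← hBB]
        rintro y (hy | hy) z (hz | hz) hyz
        · simp [hy, hz]
        · exact absurd hyz (hB12 y hy z hz)
        · exact absurd hyz.symm (hB12 z hz y hy)
        · have e1 : y ∉ B₁ := fun hy' => hB12 y hy' y hy (Touch.refl y)
          have e2 : z ∉ B₁ := fun hz' => hB12 z hz' z hz (Touch.refl z)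
          simp [e1, e2]) hbm hbm' heq
      exact hB12 b' (this.mp hbB) b' hbB' (Touch.refl b')
  -- As `A` and `C` are disjoint, the complement of `BX` is the union of the complements of the
  -- discs `ABX` and `CBX`; these are connected and meet in the nonempty complement of `ABCX`.
  · have hun : (↑(B ∪ X) : Set (Bond L M))ᶜ =
        (↑(A ∪ B ∪ X) : Set (Bond L M))ᶜ ∪ (↑(C ∪ B ∪ X) : Set (Bond L M))ᶜ := by
      ext b
      have := fun ha hc => hAC b ha b hc (Touch.refl b)
      simp only [Finset.coe_union, Set.mem_compl_iff, Set.mem_union, SetLike.mem_coe]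
      tauto
    have hne : (↑(A ∪ B ∪ C ∪ X) : Set (Bond L M))ᶜ.Nonempty := by
      obtain ⟨S₁, S₂, hS, -, h1, -⟩ := exists_split_of_numComp_eq_two w2
      exact hS ▸ (numComp_eq_one_iff.1 h1).1.mono Set.subset_union_left
    obtain ⟨b, hb⟩ := hne
    obtain ⟨n1, l1⟩ := numComp_eq_one_iff.1 c1
    obtain ⟨n2, l2⟩ := numComp_eq_one_iff.1 c2
    rw [hun, numComp_eq_one_iff]
    refine ⟨n1.mono Set.subset_union_left, l1.union l2 ⟨b, ?_⟩⟩
    simp only [Finset.coe_union, Set.mem_compl_iff, Set.mem_union, SetLike.mem_coe, Set.mem_inter_iff]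
      at hb ⊢
    tauto

end Topology

/-! ### Gradients, flat configurations and the purity formula -/

section Purity

variable {d L M : ℕ}

/-- The lattice gradient. -/
def grad : (Site L M → ZMod d) →+ Config d L M where
  toFun g b := g (tail b) - g (head b)
  map_zero' := by ext; simp
  map_add' g h := by ext b; simp only [Pi.add_apply]; ring

lemma grad_apply (g : Site L M → ZMod d) (b : Bond L M) :
    grad g b = g (tail b) - g (head b) := rfl

/-- The oriented sum of `σ` around every plaquette vanishes. -/
def IsFlat (σ : Config d L M) : Prop :=
  ∀ p : Site L M, σ (p, false) + σ (right p, true) - σ (up p, false) - σ (p, true) = 0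

lemma IsFlat.sub {σ τ : Config d L M} (hσ : IsFlat σ) (hτ : IsFlat τ) : IsFlat (σ - τ) := by
  intro p
  have h1 := hσ p
  have h2 := hτ p
  simp only [Pi.sub_apply]
  linear_combination h1 - h2

/-- Identifies the star operator with a translation by a gradient. It also holds when `L` or `M` is
1, where a loop bond receives both `m` and `-m`. -/
lemma grad_single (v : Site L M) (m : ZMod d) :
    grad (Pi.single v m) = Pi.single (v, false) m + Pi.single (v, true) m
      + Pi.single (left v, false) (-m) + Pi.single (down v, true) (-m) := by
  have hl : ∀ w : Site L M, right w = v ↔ w = left v := fun w => by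
    simp only [right, left, Prod.ext_iff, eq_sub_iff_add_eq]
  have hd : ∀ w : Site L M, up w = v ↔ w = down v := fun w => by
    simp only [up, down, Prod.ext_iff, eq_sub_iff_add_eq]
  ext ⟨w, s⟩
  cases s
  · simp only [grad_apply, tail, head, Pi.single_apply, Pi.add_apply, Prod.mk.injEq, and_true,
      and_false, Bool.false_eq_true, if_false, hl]
    split_ifs <;> ring
  · simp only [grad_apply, tail, head, Pi.single_apply, Pi.add_apply, Prod.mk.injEq, and_true,
      and_false, Bool.true_eq_false, if_true, if_false, hd]
    split_ifs <;> ring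

/-! Potentials of flat configurations. -/

/-- Partial sums of `f` along a cycle of length `n`. -/
def cycleSum {n : ℕ} (f : ZMod n → ZMod d) (y : ZMod n) : ZMod d :=
  ∑ k ∈ Finset.range y.val, f k

/-- The partial sum is an antiderivative except at the wrap-around, where it is one only if the
total sum around the cycle vanishes. -/
lemma cycleSum_add_one {n : ℕ} [NeZero n] (f : ZMod n → ZMod d) (y : ZMod n)
    (h : y + 1 ≠ 0 ∨ ∑ k ∈ Finset.range n, f k = 0) :
    cycleSum f (y + 1) = cycleSum f y + f y := by
  have hy : ((y.val : ℕ) : ZMod n) = y := ZMod.natCast_zmod_val y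
  have hc : ((y.val + 1 : ℕ) : ZMod n) = y + 1 := by push_cast; rw [hy]
  rcases Nat.lt_or_ge (y.val + 1) n with hlt | hge
  · have hv : (y + 1).val = y.val + 1 := by rw [← hc, ZMod.val_natCast_of_lt hlt]
    rw [cycleSum, hv, Finset.sum_range_succ, hy, cycleSum]
  · have hn : y.val + 1 = n := le_antisymm (ZMod.val_lt y) hge
    have h0 : y + 1 = 0 := by rw [← hc, hn, ZMod.natCast_self]
    have ht := h.resolve_left (not_not.2 h0)
    have hs : Finset.range n = Finset.range (y.val + 1) := by rw [hn]
    rw [hs, Finset.sum_range_succ, hy] at ht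
    rw [h0, cycleSum, ZMod.val_zero, Finset.range_zero, Finset.sum_empty, cycleSum]
    exact ht.symm

/-- Discrete Stokes theorem on a vertical strip of `n` plaquettes. -/
lemma IsFlat.sum_column {σ : Config d L M} (h : IsFlat σ) (x : ZMod L) (y : ZMod M) (n : ℕ) :
    ∑ l ∈ Finset.range n, σ ((x + 1, y + l), true) =
      ∑ l ∈ Finset.range n, σ ((x, y + l), true) + σ ((x, y + n), false) - σ ((x, y), false) := by
  induction n with
  | zero => simp
  | succ n ih =>
    have := h (x, y + n)
    simp only [right, up] at this
    rw [Finset.sum_range_succ, Finset.sum_range_succ, ih]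
    push_cast
    rw [← add_assoc y]
    linear_combination this

variable [NeZero L] [NeZero M]

/-- A potential for `σ`, obtained by summing along the row of `a` and then along a column. -/
def potential (σ : Config d L M) (a : Site L M) : Site L M → ZMod d := fun v =>
  -(cycleSum (fun k => σ ((a.1 + k, a.2), false)) (v.1 - a.1) +
    cycleSum (fun l => σ ((v.1, a.2 + l), true)) (v.2 - a.2))

lemma IsFlat.grad_potential_horizontal {σ : Config d L M} (h : IsFlat σ) (a v : Site L M)
    (hv : (right v).1 ≠ a.1 ∨ ∀ x, σ ((x, a.2), false) = 0) :
    grad (potential σ a) (v, false) = σ (v, false) := by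
  obtain ⟨x, y⟩ := v
  have h1 := cycleSum_add_one (fun k => σ ((a.1 + k, a.2), false)) (x - a.1) (by
    refine hv.imp (fun h h' => h (?_ : x + 1 = a.1)) fun h => Finset.sum_eq_zero fun k _ => h _
    linear_combination h')
  have h2 := h.sum_column x a.2 (y - a.2).val
  rw [ZMod.natCast_zmod_val] at h2
  simp only [add_sub_cancel] at h1 h2
  have e : x - a.1 + 1 = x + 1 - a.1 := by ring
  rw [e] at h1
  simp only [grad_apply, tail, head, potential, right, Bool.false_eq_true, if_false]
  rw [h1]
  simp only [cycleSum] at h2 ⊢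
  rw [h2]
  ring

lemma IsFlat.grad_potential_vertical {σ : Config d L M} (h : IsFlat σ) (a v : Site L M)
    (hv : (up v).2 ≠ a.2 ∨ ∀ y, σ ((a.1, y), true) = 0) :
    grad (potential σ a) (v, true) = σ (v, true) := by
  obtain ⟨x, y⟩ := v
  have h1 := cycleSum_add_one (fun l => σ ((x, a.2 + l), true)) (y - a.2) (by
    refine hv.imp (fun hne h' => hne (?_ : y + 1 = a.2)) fun h0 => ?_
    -- For height `M` the two horizontal terms of the strip coincide, so all columns have the same
    -- holonomy, namely the vanishing one of column `a.1`.
    · have hz : ∀ z, ∑ l ∈ Finset.range M, σ ((a.1 + z, a.2 + (l : ZMod M)), true) = 0 := by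
        apply zmod_induction
        · exact Finset.sum_eq_zero fun l _ => by rw [add_zero]; exact h0 _
        · intro z ih
          rw [← add_assoc, h.sum_column, ih, ZMod.natCast_self]
          simp
      have := hz (x - a.1)
      rwa [add_sub_cancel] at this
    · linear_combination h')
  simp only [add_sub_cancel] at h1
  have e : y - a.2 + 1 = y + 1 - a.2 := by ring
  rw [e] at h1
  simp only [grad_apply, tail, head, potential, up, if_true]
  rw [h1]
  ring

/-- A flat configuration is a gradient on every contractible patch. -/
lemma IsFlat.exists_grad_eq_on {σ : Config d L M} (h : IsFlat σ) {Λ : Finset (Bond L M)}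
    (hΛ : InPatch Λ) : ∃ g, ∀ b ∈ Λ, grad g b = σ b := by
  obtain ⟨a, ha⟩ := hΛ
  refine ⟨potential σ a, ?_⟩
  rintro ⟨v, s⟩ hb
  cases s
  · exact h.grad_potential_horizontal a v (Or.inl (ha _ hb _ (Or.inr rfl)).1)
  · exact h.grad_potential_vertical a v (Or.inl (ha _ hb _ (Or.inr rfl)).2)

/-- A flat configuration supported in a contractible patch is a gradient. -/
lemma IsFlat.exists_grad_eq {σ : Config d L M} (h : IsFlat σ) {Λ : Finset (Bond L M)}
    (hΛ : InPatch Λ) (h0 : ∀ b, b ∉ Λ → σ b = 0) : ∃ g, grad g = σ := by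
  obtain ⟨a, ha⟩ := hΛ
  refine ⟨potential σ a, ?_⟩
  ext ⟨v, s⟩
  cases s
  · exact h.grad_potential_horizontal a v (Or.inr fun x => h0 _ fun hb =>
      (ha _ hb _ (Or.inl rfl)).2 rfl)
  · exact h.grad_potential_vertical a v (Or.inr fun y => h0 _ fun hb =>
      (ha _ hb _ (Or.inl rfl)).1 rfl)

/-! Ground states are supported on flat configurations and are invariant under gradients. -/

section GroundStates

variable [NeZero d]

lemma shiftOp_mulVec (b : Bond L M) (m : ZMod d) (ψ : Config d L M → ℂ) (σ : Config d L M) :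
    (shiftOp b m).mulVec ψ σ = ψ (σ - Pi.single b m) := by
  have h : ∀ τ : Config d L M, σ = Function.update τ b (τ b + m) ↔ τ = σ - Pi.single b m := by
    intro τ
    have : Function.update τ b (τ b + m) = τ + Pi.single b m := by
      ext c
      by_cases hc : c = b
      · subst hc; simp
      · simp [hc]
    rw [this, eq_sub_iff_add_eq, eq_comm]
  simp only [Matrix.mulVec, dotProduct, shiftOp, h, ite_mul, one_mul, zero_mul,
    Finset.sum_ite_eq', Finset.mem_univ, if_true]

lemma starOp_mulVec (v : Site L M) (m : ZMod d) (ψ : Config d L M → ℂ) (σ : Config d L M) :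
    (starOp m v).mulVec ψ σ = ψ (σ - grad (Pi.single v m)) := by
  simp only [starOp, ← Matrix.mulVec_mulVec, shiftOp_mulVec, grad_single]
  congr 1
  abel

lemma apply_add_grad_single {ψ : Config d L M → ℂ} (hψ : ψ ∈ groundSpace d L M)
    (σ : Config d L M) (v : Site L M) (k : ZMod d) :
    ψ (σ + grad (Pi.single v k)) = ψ σ := by
  have h : ∀ τ, (d : ℂ)⁻¹ * ∑ m : ZMod d, ψ (τ - grad (Pi.single v m)) = ψ τ := by
    intro τ
    conv_rhs => rw [← hψ.1 v]
    simp only [starProj, Matrix.smul_mulVec, Pi.smul_apply, smul_eq_mul, Matrix.sum_mulVec,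
      Finset.sum_apply, starOp_mulVec]
  rw [← h, ← h σ]
  congr 1
  -- The average over all shifts at `v` is unchanged by a further shift: translate the summation
  -- index.
  refine Fintype.sum_equiv (Equiv.subRight k) _ _ fun m => ?_
  rw [Equiv.subRight_apply, Pi.single_sub, map_sub]
  congr 1
  abel

lemma apply_add_grad {ψ : Config d L M → ℂ} (hψ : ψ ∈ groundSpace d L M)
    (σ : Config d L M) (g : Site L M → ZMod d) : ψ (σ + grad g) = ψ σ := by
  have h : ∀ s : Finset (Site L M), ψ (σ + grad (∑ v ∈ s, Pi.single v (g v))) = ψ σ := by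
    intro s
    induction s using Finset.induction_on with
    | empty => simp
    | insert v s hv ih =>
      rw [Finset.sum_insert hv, map_add, add_comm (grad _) (grad _), ← add_assoc,
        apply_add_grad_single hψ, ih]
  simpa [Finset.univ_sum_single] using h Finset.univ

lemma isFlat_of_ne_zero {ψ : Config d L M → ℂ} (hψ : ψ ∈ groundSpace d L M)
    {σ : Config d L M} (hσ : ψ σ ≠ 0) : IsFlat σ := by
  intro p
  by_contra hp
  apply hσ
  rw [← hψ.2 p, Matrix.mulVec, dotProduct]
  refine Finset.sum_eq_zero fun τ _ => mul_eq_zero_of_left ?_ _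
  rw [plaqProj, Matrix.sum_apply]
  refine Finset.sum_eq_zero fun m _ => ?_
  split_ifs with hm
  · simp only [projOp, Matrix.diagonal_mul_diagonal, Matrix.diagonal_apply]
    split_ifs <;> simp
    next h1 h2 h3 h4 => exact hp (by rw [h1, h2, h3, h4]; exact hm)
  · rfl

end GroundStates

/-! Counting locally constant functions. -/

/-- Functions on sites that are constant along the bonds of `S`. -/
def locConst (d : ℕ) (S : Set (Bond L M)) : AddSubgroup (Site L M → ZMod d) where
  carrier := {g | ∀ b ∈ S, grad g b = 0}
  zero_mem' := by intro b _; simp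
  add_mem' hg hh b hb := by rw [map_add, Pi.add_apply, hg b hb, hh b hb, add_zero]
  neg_mem' hg b hb := by rw [map_neg, Pi.neg_apply, hg b hb, neg_zero]

/-- The sites joined to `S`. -/
def sites (S : Set (Bond L M)) : Set (Site L M) := {v | ∃ b ∈ S, Inc v b}

omit [NeZero L] [NeZero M] in
lemma apply_eq_tail {S : Set (Bond L M)} {g : Site L M → ZMod d} (hg : g ∈ locConst d S)
    {b : Bond L M} (hb : b ∈ S) {v : Site L M} (hv : Inc v b) : g v = g (tail b) := by
  rcases hv with rfl | rfl
  · rfl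
  · exact (sub_eq_zero.1 (hg b hb)).symm

/-- Such a function is one free value per component of `S` and one per site not joined to `S`. The
factor on the left avoids subtraction in the exponent. -/
lemma card_locConst (S : Set (Bond L M)) :
    Nat.card (locConst d S) * d ^ (sites S).ncard = d ^ (numComp S + Nat.card (Site L M)) := by
  classical
  choose r hr hrK using fun K : Comp S => exists_compOf_eq K
  let F : locConst d S → (Comp S → ZMod d) × ({v // v ∉ sites S} → ZMod d) := fun g =>
    (fun K => g.1 (tail (r K)), fun v => g.1 v)
  have hF : Function.Bijective F := by
    constructor
    · rintro ⟨g, hg⟩ ⟨g', hg'⟩ h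
      obtain ⟨h1, h2⟩ := Prod.ext_iff.1 h
      ext v
      by_cases hv : v ∈ sites S
      · obtain ⟨b, hb, hvb⟩ := hv
        have key : ∀ g ∈ locConst d S, g v = g (tail (r (compOf S b hb))) := by
          intro g hg
          rw [apply_eq_tail hg hb hvb]
          refine eq_of_compOf_eq (fun b => g (tail b)) ?_ hb (hr _) (hrK _).symm
          rintro x hx y hy ⟨w, hwx, hwy⟩
          exact (apply_eq_tail hg hx hwx).symm.trans (apply_eq_tail hg hy hwy)
        exact (key g hg).trans ((congrFun h1 _).trans (key g' hg').symm)
      · exact congrFun h2 ⟨v, hv⟩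
    · rintro ⟨f, h⟩
      let g : Site L M → ZMod d := fun v =>
        if hv : v ∈ sites S then f (compOf S hv.choose hv.choose_spec.1) else h ⟨v, hv⟩
      have hg : ∀ b (hb : b ∈ S) v, Inc v b → g v = f (compOf S b hb) := by
        intro b hb v hvb
        have hv : v ∈ sites S := ⟨b, hb, hvb⟩
        simp only [g, dif_pos hv]
        congr 1
        exact compOf_eq_of_touch _ _ ⟨v, hv.choose_spec.2, hvb⟩
      refine ⟨⟨g, fun b hb => ?_⟩, Prod.ext (funext fun K => ?_) (funext fun v => dif_neg v.2)⟩
      · rw [grad_apply, hg b hb _ (Or.inl rfl), hg b hb _ (Or.inr rfl), sub_self]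
      · change g (tail (r K)) = f K
        rw [hg (r K) (hr K) _ (Or.inl rfl), hrK]
  rw [Nat.card_eq_of_bijective F hF, Nat.card_prod, Nat.card_fun, Nat.card_fun, Nat.card_zmod,
    mul_assoc, ← pow_add, ← pow_add, ← Set.ncard_add_ncard_compl (sites S),
    add_comm (sites S).ncard]
  rfl

lemma card_locConst_univ : Nat.card (locConst d (Set.univ : Set (Bond L M))) = d := by
  conv_rhs => rw [← Nat.card_zmod d]
  refine (Nat.card_eq_of_bijective (fun c : ZMod d =>
    (⟨fun _ => c, fun b _ => sub_self c⟩ : locConst d (Set.univ : Set (Bond L M)))) ⟨?_, ?_⟩).symm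
  · intro c c' h
    exact congrFun (congrArg Subtype.val h) 0
  · rintro ⟨g, hg⟩
    refine ⟨g 0, Subtype.ext (funext fun v => ?_)⟩
    have h1 : ∀ x : ZMod L, g (x, 0) = g 0 := zmod_induction rfl fun x hx => by
      rw [← hx]; exact (sub_eq_zero.1 (hg ((x, 0), false) trivial)).symm
    have h2 : ∀ y : ZMod M, g (v.1, y) = g 0 := zmod_induction (h1 _) fun y hy => by
      rw [← hy]; exact (sub_eq_zero.1 (hg ((v.1, y), true) trivial)).symm
    exact (h2 v.2).symm

/-! Gradients restricted to a region. -/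

/-- The gradient restricted to `Λ`. -/
def gradOn (d : ℕ) (Λ : Finset (Bond L M)) : (Site L M → ZMod d) →+ ({b // b ∈ Λ} → ZMod d) where
  toFun g b := grad g b
  map_zero' := by ext; simp
  map_add' g h := by ext; simp

/-- Restrictions to `Λ` of gradients that vanish outside `Λ`. -/
def innerGrad (d : ℕ) (Λ : Finset (Bond L M)) : AddSubgroup ({b // b ∈ Λ} → ZMod d) :=
  ((gradOn d Λ).comp (locConst d (Λ : Set (Bond L M))ᶜ).subtype).range

omit [NeZero L] [NeZero M] in
lemma card_range_mul_card_ker {V W : Type*} [AddGroup V] [AddGroup W] (f : V →+ W) :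
    Nat.card f.range * Nat.card f.ker = Nat.card V := by
  rw [← AddSubgroup.index_ker, mul_comm, AddSubgroup.card_mul_index]

lemma card_range_gradOn (Λ : Finset (Bond L M)) :
    Nat.card (gradOn d Λ).range * Nat.card (locConst d (Λ : Set (Bond L M))) =
      d ^ Nat.card (Site L M) := by
  have hk : (gradOn d Λ).ker = locConst d (Λ : Set (Bond L M)) := by
    ext g
    exact ⟨fun h b hb => congrFun h ⟨b, hb⟩, fun h => funext fun b => h b b.2⟩
  rw [← hk, card_range_mul_card_ker, Nat.card_fun, Nat.card_zmod]

/-- The factor `d` counts the kernel: a function whose gradient vanishes both on and off `Λ` is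
constant. -/
lemma card_innerGrad (Λ : Finset (Bond L M)) :
    Nat.card (innerGrad d Λ) * d = Nat.card (locConst d (Λ : Set (Bond L M))ᶜ) := by
  rw [← card_range_mul_card_ker ((gradOn d Λ).comp (locConst d (Λ : Set (Bond L M))ᶜ).subtype)]
  change Nat.card (innerGrad d Λ) * d = Nat.card (innerGrad d Λ) * _
  congr 1
  conv_lhs => rw [← card_locConst_univ (d := d) (L := L) (M := M)]
  refine Nat.card_congr ⟨fun g => ⟨⟨g.1, fun b _ => g.2 b trivial⟩, funext fun b => g.2 b trivial⟩,
    fun g => ⟨g.1.1, fun b _ => ?_⟩, fun g => rfl, fun g => rfl⟩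
  by_cases hb : b ∈ Λ
  · exact congrFun g.2 ⟨b, hb⟩
  · exact g.1.2 b hb

/-- Inclusion–exclusion: every site meets `Λ` or its complement, and the boundary consists of the
sites meeting both. -/
lemma ncard_sites_add (Λ : Finset (Bond L M)) :
    (sites (Λ : Set (Bond L M))).ncard + (sites (Λ : Set (Bond L M))ᶜ).ncard =
      Nat.card (Site L M) + (bdry Λ).ncard := by
  rw [← Set.ncard_union_add_ncard_inter _ _ (Set.toFinite _) (Set.toFinite _), ← Set.ncard_univ]
  congr 2
  refine Set.eq_univ_of_forall fun v => ?_
  by_cases h : (v, false) ∈ Λ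
  · exact Or.inl ⟨_, h, Or.inl rfl⟩
  · exact Or.inr ⟨_, h, Or.inl rfl⟩

lemma card_innerGrad_mul [NeZero d] (Λ : Finset (Bond L M)) :
    Nat.card (innerGrad d Λ) * d ^ ((bdry Λ).ncard + 1) =
      Nat.card (gradOn d Λ).range *
        d ^ (numComp (Λ : Set (Bond L M)) + numComp (Λ : Set (Bond L M))ᶜ) := by
  have h1 := card_locConst (d := d) (Λ : Set (Bond L M))
  have h2 := card_locConst (d := d) (Λ : Set (Bond L M))ᶜ
  have h3 := card_range_gradOn (d := d) Λ
  have h4 := card_innerGrad (d := d) Λ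
  have h5 := congrArg (d ^ ·) (ncard_sites_add Λ)
  simp only [pow_add] at h1 h2 h5
  have hd : 0 < d := Nat.pos_of_ne_zero (NeZero.ne d)
  refine Nat.eq_of_mul_eq_mul_right (m := Nat.card (locConst d (Λ : Set (Bond L M))) *
    (d ^ (sites (Λ : Set (Bond L M))).ncard * d ^ (sites (Λ : Set (Bond L M))ᶜ).ncard))
    (Nat.mul_pos Nat.card_pos (Nat.mul_pos (pow_pos hd _) (pow_pos hd _))) ?_
  calc _ = (Nat.card (innerGrad d Λ) * d) * d ^ (sites (Λ : Set (Bond L M))ᶜ).ncard *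
        (Nat.card (locConst d (Λ : Set (Bond L M))) * d ^ (sites (Λ : Set (Bond L M))).ncard) *
          d ^ (bdry Λ).ncard := by ring
    _ = (Nat.card (gradOn d Λ).range * Nat.card (locConst d (Λ : Set (Bond L M)))) *
        d ^ (numComp (Λ : Set (Bond L M)) + numComp (Λ : Set (Bond L M))ᶜ) *
          (d ^ Nat.card (Site L M) * d ^ (bdry Λ).ncard) := by
      rw [h4, h2, h1, h3]; ring
    _ = _ := by rw [← h5]; ring

/-! The purity of a region in a contractible patch. -/

section Reduced

variable [NeZero d]

omit [NeZero L] [NeZero M] [NeZero d] in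
lemma glue_add_grad (Λ : Finset (Bond L M)) (a : {b // b ∈ Λ} → ZMod d)
    (c : {b // b ∉ Λ} → ZMod d) (g : Site L M → ZMod d) :
    glue Λ (a + gradOn d Λ g) (c + fun b : {b // b ∉ Λ} => grad g b) = glue Λ a c + grad g := by
  ext b
  by_cases hb : b ∈ Λ <;> simp [glue, hb, gradOn]

lemma reduced_pureState_apply (Λ : Finset (Bond L M)) (ψ : Config d L M → ℂ)
    (a a' : {b // b ∈ Λ} → ZMod d) :
    reduced Λ (pureState ψ) a a' =
      ∑ c : {b // b ∉ Λ} → ZMod d, ψ (glue Λ a c) * star (ψ (glue Λ a' c)) := rfl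

lemma reduced_trace {ψ : Config d L M → ℂ} (hnorm : ∑ σ, ‖ψ σ‖ ^ 2 = 1) (Λ : Finset (Bond L M)) :
    ∑ a, reduced Λ (pureState ψ) a a = 1 := by
  simp only [reduced_pureState_apply]
  rw [← Fintype.sum_prod_type' (fun a c => ψ (glue Λ a c) * star (ψ (glue Λ a c))),
    Fintype.sum_equiv (Equiv.piEquivPiSubtypeProd (· ∈ Λ) fun _ => ZMod d).symm
      (fun x => ψ (glue Λ x.1 x.2) * star (ψ (glue Λ x.1 x.2))) (fun σ => ψ σ * star (ψ σ))
      fun x => rfl]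
  have : ((∑ σ, ‖ψ σ‖ ^ 2 : ℝ) : ℂ) = 1 := by rw [hnorm]; simp
  rw [← this]
  push_cast
  exact Finset.sum_congr rfl fun σ _ => Complex.mul_conj' _

-- The reduced state is constant on blocks. Invariance under gradients makes all allowed entries
-- equal; flatness, in a patch, kills the others.
open Classical in
lemma reduced_apply {ψ : Config d L M → ℂ} (hψ : ψ ∈ groundSpace d L M) {Λ : Finset (Bond L M)}
    (hΛ : InPatch Λ) (a a' : {b // b ∈ Λ} → ZMod d) :
    reduced Λ (pureState ψ) a a' = if a ∈ (gradOn d Λ).range ∧ a' - a ∈ innerGrad d Λ then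
      reduced Λ (pureState ψ) 0 0 else 0 := by
  split_ifs with h
  · obtain ⟨⟨g, rfl⟩, ⟨⟨k, hk⟩, hka⟩⟩ := h
    obtain rfl : a' = gradOn d Λ g + gradOn d Λ k := by
      rw [← sub_eq_iff_eq_add']; exact hka.symm
    simp only [reduced_pureState_apply]
    -- Shift the environment along with `g`; `k` does not affect it, since its gradient vanishes
    -- outside `Λ`.
    refine (Fintype.sum_equiv (Equiv.addRight fun b : {b // b ∉ Λ} => grad g b) _ _ fun c => ?_).symm
    have h1 := glue_add_grad Λ 0 c g
    have h2 := glue_add_grad Λ (gradOn d Λ g) (c + fun b : {b // b ∉ Λ} => grad g b) k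
    have h0 : (fun b : {b // b ∉ Λ} => grad k b) = 0 := funext fun b => hk b b.2
    rw [h0, add_zero] at h2
    rw [zero_add] at h1
    rw [Equiv.coe_addRight, h2, apply_add_grad hψ, h1, apply_add_grad hψ]
  · rw [reduced_pureState_apply]
    refine Finset.sum_eq_zero fun c _ => ?_
    by_contra hne
    have f1 := isFlat_of_ne_zero hψ (left_ne_zero_of_mul hne)
    have f2 := isFlat_of_ne_zero hψ (star_ne_zero.1 (right_ne_zero_of_mul hne))
    -- The first configuration need only be a gradient on `Λ`. The difference of the two vanishes
    -- outside `Λ`, since they share `c`, so it is a gradient on the whole torus.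
    obtain ⟨g, hg⟩ := f1.exists_grad_eq_on hΛ
    obtain ⟨k, hk⟩ := (f2.sub f1).exists_grad_eq hΛ fun b hb => by simp [glue, hb]
    refine h ⟨⟨g, funext fun b => ?_⟩, ⟨⟨k, fun b hb => ?_⟩, funext fun b => ?_⟩⟩
    · exact (hg b b.2).trans (by simp [glue])
    · have hb' : b ∉ Λ := hb
      rw [hk]; simp [glue, hb']
    · exact (congrFun hk b).trans (by simp [glue])

omit [NeZero L] [NeZero M] [NeZero d] in
lemma innerGrad_le (Λ : Finset (Bond L M)) : innerGrad d Λ ≤ (gradOn d Λ).range := by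
  rintro _ ⟨g, rfl⟩
  exact ⟨g.1, rfl⟩

lemma purity_eq_card_div {ψ : Config d L M → ℂ} (hψ : ψ ∈ groundSpace d L M)
    (hnorm : ∑ σ, ‖ψ σ‖ ^ 2 = 1) {Λ : Finset (Bond L M)} (hΛ : InPatch Λ) :
    purity Λ (pureState ψ) = Nat.card (innerGrad d Λ) / Nat.card (gradOn d Λ).range := by
  classical
  set q := reduced Λ (pureState ψ) 0 0 with hq
  have hR : ((Nat.card (gradOn d Λ).range : ℕ) : ℂ) ≠ 0 := Nat.cast_ne_zero.2 Nat.card_pos.ne'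
  have cardR : (Finset.univ.filter (· ∈ (gradOn d Λ).range)).card =
      Nat.card (gradOn d Λ).range := by
    rw [Nat.card_eq_fintype_card, Fintype.card_subtype]
  have cardG : ∀ a, (Finset.univ.filter fun a' => a' - a ∈ innerGrad d Λ).card =
      Nat.card (innerGrad d Λ) := by
    intro a
    rw [← Fintype.card_subtype, ← Nat.card_eq_fintype_card]
    exact Nat.card_congr ((Equiv.subRight a).subtypeEquiv fun _ => Iff.rfl)
  -- Normalization fixes the common entry: `q = 1 / |R|`.
  have htr : (Nat.card (gradOn d Λ).range : ℂ) * q = 1 := by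
    rw [← reduced_trace hnorm Λ]
    have hdiag : ∀ a, reduced Λ (pureState ψ) a a =
        if a ∈ (gradOn d Λ).range then q else 0 := by
      intro a
      rw [reduced_apply hψ hΛ a a]
      simp only [sub_self, zero_mem, and_true, hq]
    rw [Finset.sum_congr rfl fun a _ => hdiag a, ← Finset.sum_filter, Finset.sum_const, cardR,
      nsmul_eq_mul]
  have hprod : ∀ a a', reduced Λ (pureState ψ) a a' * reduced Λ (pureState ψ) a' a =
      if a ∈ (gradOn d Λ).range then if a' - a ∈ innerGrad d Λ then q * q else 0 else 0 := by
    intro a a'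
    rw [reduced_apply hψ hΛ a a', reduced_apply hψ hΛ a' a, ← hq]
    by_cases h1 : a ∈ (gradOn d Λ).range <;> by_cases h2 : a' - a ∈ innerGrad d Λ
    · have h3 : a' ∈ (gradOn d Λ).range := by
        have := add_mem h1 (innerGrad_le Λ h2)
        rwa [add_sub_cancel] at this
      have h4 : a - a' ∈ innerGrad d Λ := by rw [← neg_sub]; exact neg_mem h2
      simp only [h1, h2, h3, h4, and_self, if_true]
    · simp only [h1, h2, and_false, if_false, zero_mul, if_true]
    · simp only [h1, false_and, if_false, zero_mul]
    · simp only [h1, false_and, if_false, zero_mul]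
  rw [purity, Matrix.trace]
  have hdiag : ∀ a, (reduced Λ (pureState ψ) * reduced Λ (pureState ψ)).diag a =
      ∑ a', reduced Λ (pureState ψ) a a' * reduced Λ (pureState ψ) a' a := fun a => rfl
  simp only [hdiag, hprod]
  have hin : ∀ a : {b // b ∈ Λ} → ZMod d, (∑ a', if a ∈ (gradOn d Λ).range then
      if a' - a ∈ innerGrad d Λ then q * q else 0 else 0) =
        if a ∈ (gradOn d Λ).range then Nat.card (innerGrad d Λ) * (q * q) else 0 := by
    intro a
    split_ifs
    · rw [← Finset.sum_filter, Finset.sum_const, cardG, nsmul_eq_mul]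
    · simp
  simp only [hin]
  rw [← Finset.sum_filter, Finset.sum_const, cardR, nsmul_eq_mul, eq_div_iff hR]
  linear_combination (Nat.card (innerGrad d Λ) : ℂ) * (1 + Nat.card (gradOn d Λ).range * q) * htr

/-- The purity of a region in a contractible patch is determined by the length of its boundary and
the numbers of components of the region and of its complement. -/
lemma purity_mul_pow {ψ : Config d L M → ℂ} (hψ : ψ ∈ groundSpace d L M)
    (hnorm : ∑ σ, ‖ψ σ‖ ^ 2 = 1) {Λ : Finset (Bond L M)} (hΛ : InPatch Λ) :
    purity Λ (pureState ψ) = (d : ℂ) ^ (numComp (Λ : Set (Bond L M)) +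
      numComp (Λ : Set (Bond L M))ᶜ) / (d : ℂ) ^ ((bdry Λ).ncard + 1) := by
  have hR : ((Nat.card (gradOn d Λ).range : ℕ) : ℂ) ≠ 0 := Nat.cast_ne_zero.2 Nat.card_pos.ne'
  have hd : (d : ℂ) ≠ 0 := Nat.cast_ne_zero.2 (NeZero.ne d)
  rw [purity_eq_card_div hψ hnorm hΛ, div_eq_div_iff hR (pow_ne_zero _ hd)]
  have := card_innerGrad_mul (d := d) Λ
  rw [mul_comm ((d : ℂ) ^ _)]
  exact_mod_cast this

end Reduced

end Purity

/-! ### Cancellation in the ratio and the balance of components -/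

section TopologicalPurity

variable {L M : ℕ}

lemma nSites_eq (i : ℕ) (Λ : Finset (Bond L M)) :
    nSites i Λ = {v | v ∈ bdry Λ ∧ {b | b ∈ Λ ∧ Inc v b}.ncard = i}.ncard := rfl

lemma bdry_congr (S T : Finset (Bond L M)) (v : Site L M)
    (h : ∀ b, Inc v b → (b ∈ S ↔ b ∈ T)) : v ∈ bdry S ↔ v ∈ bdry T := by
  have h1 : (∃ b ∈ S, Inc v b) ↔ ∃ b ∈ T, Inc v b :=
    exists_congr fun b => and_congr_left fun hb => h b hb
  have h2 : (∃ b, b ∉ S ∧ Inc v b) ↔ ∃ b, b ∉ T ∧ Inc v b :=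
    exists_congr fun b => and_congr_left fun hb => not_congr (h b hb)
  exact and_congr h1 h2

lemma InPatch.mono {S T : Finset (Bond L M)} (h : InPatch T) (hST : S ⊆ T) : InPatch S :=
  h.imp fun _ ha b hb => ha b (hST hb)

variable [NeZero L] [NeZero M]

/-- If `A` and `C` have no common site, then sets of sites that are determined by the bonds of a
region at each site have equal total sizes for `AB`, `BC` and for `B`, `ABC`. -/
lemma ncard_add_ncard_eq {A B C : Finset (Bond L M)} (h : Apart A C)
    (p : Finset (Bond L M) → Set (Site L M))
    (hp : ∀ (S T : Finset (Bond L M)) v, (∀ b, Inc v b → (b ∈ S ↔ b ∈ T)) → (v ∈ p S ↔ v ∈ p T)) :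
    (p (A ∪ B)).ncard + (p (B ∪ C)).ncard = (p B).ncard + (p (A ∪ B ∪ C)).ncard := by
  -- At a site without bonds of `C`, `AB` looks like `ABC` and `BC` like `B`; at a site without
  -- bonds of `A` the roles are exchanged.
  have hv : ∀ v, ((v ∈ p (A ∪ B) ↔ v ∈ p (A ∪ B ∪ C)) ∧ (v ∈ p (B ∪ C) ↔ v ∈ p B)) ∨
      ((v ∈ p (A ∪ B) ↔ v ∈ p B) ∧ (v ∈ p (B ∪ C) ↔ v ∈ p (A ∪ B ∪ C))) := by
    intro v
    by_cases hA : ∃ b ∈ A, Inc v b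
    · obtain ⟨a, ha, hva⟩ := hA
      have hC : ∀ b, Inc v b → b ∉ C := fun b hb hbC => h a ha b hbC v ⟨hva, hb⟩
      left
      constructor <;> apply hp <;> intro b hb <;> simp [hC b hb]
    · push Not at hA
      have hA' : ∀ b, Inc v b → b ∉ A := fun b hb hbA => hA b hbA hb
      right
      constructor <;> apply hp <;> intro b hb <;> simp [hA' b hb]
  rw [← Set.ncard_union_add_ncard_inter _ _ (Set.toFinite _) (Set.toFinite _),
    ← Set.ncard_union_add_ncard_inter (p B) _ (Set.toFinite _) (Set.toFinite _)]
  congr 2 <;> ext v <;> have := hv v <;> simp only [Set.mem_union, Set.mem_inter_iff] <;> tauto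

lemma ncard_bdry_add {A B C : Finset (Bond L M)} (h : Apart A C) :
    (bdry (A ∪ B)).ncard + (bdry (B ∪ C)).ncard = (bdry B).ncard + (bdry (A ∪ B ∪ C)).ncard :=
  ncard_add_ncard_eq h bdry bdry_congr

lemma nSites_add {A B C : Finset (Bond L M)} (h : Apart A C) (i : ℕ) :
    nSites i (A ∪ B) + nSites i (B ∪ C) = nSites i B + nSites i (A ∪ B ∪ C) := by
  simp only [nSites_eq]
  refine ncard_add_ncard_eq h
    (fun Λ => {v | v ∈ bdry Λ ∧ {b | b ∈ Λ ∧ Inc v b}.ncard = i}) fun S T v hv => ?_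
  have : {b | b ∈ S ∧ Inc v b} = {b | b ∈ T ∧ Inc v b} :=
    Set.ext fun b => and_congr_left fun hb => hv b hb
  simp only [Set.mem_ofPred_eq, this, bdry_congr S T v hv]

lemma shapeCorr_add (d : ℕ) {A B C : Finset (Bond L M)} (h : Apart A C) :
    shapeCorr d (A ∪ B) + shapeCorr d (B ∪ C) = shapeCorr d B + shapeCorr d (A ∪ B ∪ C) := by
  have h2 : (nSites 2 (A ∪ B) + nSites 2 (B ∪ C) : ℝ) = nSites 2 B + nSites 2 (A ∪ B ∪ C) :=
    mod_cast nSites_add h 2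
  have h3 : (nSites 3 (A ∪ B) + nSites 3 (B ∪ C) : ℝ) = nSites 3 B + nSites 3 (A ∪ B ∪ C) :=
    mod_cast nSites_add h 3
  simp only [shapeCorr]
  linear_combination Real.logb 2 d * (h2 + 2 * h3)

/-- The total number of components of a region and of its complement. -/
noncomputable def totalComp (Λ : Finset (Bond L M)) : ℕ :=
  numComp (Λ : Set (Bond L M)) + numComp (Λ : Set (Bond L M))ᶜ

/-- The surplus 2 in the component balance is the whole exponent, since the boundary lengths cancel.
Stated for any balanced triple, it serves both the original and the deformed partition. -/
lemma topPurity_eq {d : ℕ} [NeZero d] {ψ : Config d L M → ℂ} (hψ : ψ ∈ groundSpace d L M)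
    (hnorm : ∑ σ, ‖ψ σ‖ ^ 2 = 1) {A B C : Finset (Bond L M)} (hAC : Apart A C)
    (hpatch : InPatch (A ∪ B ∪ C))
    (hc : totalComp (A ∪ B) + totalComp (B ∪ C) + 2 = totalComp B + totalComp (A ∪ B ∪ C)) :
    topPurity A B C (pureState ψ) = (((2 : ℝ) ^ (-2 * topEntropy d) : ℝ) : ℂ) := by
  have hd : (d : ℂ) ≠ 0 := Nat.cast_ne_zero.2 (NeZero.ne d)
  have hd' : (0 : ℝ) < d := Nat.cast_pos.2 (Nat.pos_of_ne_zero (NeZero.ne d))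
  have hpow : (2 : ℝ) ^ (-2 * topEntropy d) = ((d : ℝ) ^ 2)⁻¹ := by
    rw [topEntropy, mul_comm, Real.rpow_mul (by norm_num),
      Real.rpow_logb (by norm_num) (by norm_num) hd', Real.rpow_neg hd'.le, Real.rpow_two]
  have hAB : InPatch (A ∪ B) := hpatch.mono Finset.subset_union_left
  have hB : InPatch B := hAB.mono Finset.subset_union_right
  have hBC : InPatch (B ∪ C) := hpatch.mono
    (Finset.union_subset_union_left Finset.subset_union_right)
  rw [topPurity, purity_mul_pow hψ hnorm hAB, purity_mul_pow hψ hnorm hBC,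
    purity_mul_pow hψ hnorm hB, purity_mul_pow hψ hnorm hpatch, hpow]
  change (d : ℂ) ^ totalComp (A ∪ B) / _ * ((d : ℂ) ^ totalComp (B ∪ C) / _) /
    ((d : ℂ) ^ totalComp B / _ * ((d : ℂ) ^ totalComp (A ∪ B ∪ C) / _)) = _
  rw [div_mul_div_comm, div_mul_div_comm, ← pow_add, ← pow_add, ← pow_add, ← pow_add, ← hc,
    show (bdry (A ∪ B)).ncard + 1 + ((bdry (B ∪ C)).ncard + 1) =
      (bdry B).ncard + 1 + ((bdry (A ∪ B ∪ C)).ncard + 1) by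
        have := ncard_bdry_add (B := B) hAC; omega, div_div_div_cancel_right₀ (pow_ne_zero _ hd),
    pow_add _ _ 2]
  push_cast
  rw [div_mul_cancel_left₀ (pow_ne_zero _ hd)]

lemma IsAnnular.totalComp_eq {A B C : Finset (Bond L M)} (h : IsAnnular A B C) :
    totalComp (A ∪ B) + totalComp (B ∪ C) + 2 = totalComp B + totalComp (A ∪ B ∪ C) := by
  simp only [totalComp, h.conn_AB, h.compl_AB, h.conn_BC, h.compl_BC, h.conn_B, h.compl_B,
    h.conn_ABC, h.compl_ABC]

/-- A local deformation that keeps the number of boundaries keeps `A` and `C` apart, the union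
`ABC` enlarged by `X`, and the balance of the numbers of components. -/
lemma LocalDeformation.balance {A B C X A' B' C' : Finset (Bond L M)} (h : IsAnnular A B C)
    (hX : LocalDeformation A B C X A' B' C')
    (hb : numBdry (A ∪ B ∪ C ∪ X) = numBdry (A ∪ B ∪ C)) :
    Apart A' C' ∧ A' ∪ B' ∪ C' = A ∪ B ∪ C ∪ X ∧
      totalComp (A' ∪ B') + totalComp (B' ∪ C') + 2 = totalComp B' + totalComp (A' ∪ B' ∪ C') := by
  have hsw : C ∪ B ∪ A = A ∪ B ∪ C := by
    ext b; simp only [Finset.mem_union]; tauto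
  have hb' : numBdry (C ∪ B ∪ A ∪ X) = numBdry (C ∪ B ∪ A) := by rw [hsw]; exact hb
  cases hX with
  | joinA hXC =>
    obtain ⟨h1, h2, h3, h4⟩ := h.attach hXC hb
    have e1 : A ∪ X ∪ B = A ∪ B ∪ X := Finset.union_right_comm _ _ _
    have e2 : A ∪ X ∪ B ∪ C = A ∪ B ∪ C ∪ X := by rw [e1, Finset.union_right_comm]
    refine ⟨fun b hb => (Finset.mem_union.1 hb).elim (h.apart_AC b) (hXC b), e2, ?_⟩
    rw [e2, e1]
    simp only [totalComp, h1, h2, h3, h4, h.conn_BC, h.compl_BC, h.conn_B, h.compl_B]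
  | joinC hXA =>
    obtain ⟨h1, h2, h3, h4⟩ := h.symm.attach hXA hb'
    rw [hsw] at h3 h4
    have e1 : B ∪ (C ∪ X) = C ∪ B ∪ X := by rw [← Finset.union_assoc, Finset.union_comm B C]
    have e2 : A ∪ B ∪ (C ∪ X) = A ∪ B ∪ C ∪ X := (Finset.union_assoc _ _ _).symm
    refine ⟨fun b hb b' hb' => (Finset.mem_union.1 hb').elim (h.apart_AC b hb b')
      (fun hx => hXA.symm b hb b' hx), e2, ?_⟩
    rw [e2, e1]
    simp only [totalComp, h1, h2, h3, h4, h.conn_AB, h.compl_AB, h.conn_B, h.compl_B]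
  | joinB hXA hXC hB =>
    obtain ⟨h1, h2, h3, h4⟩ := h.attach hXC hb
    obtain ⟨h5, h6, -, -⟩ := h.symm.attach hXA hb'
    obtain ⟨h7, h8⟩ := h.attach_middle hXA hXC hB hb
    have e1 : A ∪ (B ∪ X) = A ∪ B ∪ X := (Finset.union_assoc _ _ _).symm
    have e2 : B ∪ X ∪ C = C ∪ B ∪ X := by rw [Finset.union_right_comm, Finset.union_comm B C]
    have e3 : A ∪ (B ∪ X) ∪ C = A ∪ B ∪ C ∪ X := by rw [e1, Finset.union_right_comm]
    refine ⟨h.apart_AC, e3, ?_⟩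
    rw [e3, e1, e2]
    simp only [totalComp, h1, h2, h3, h4, h5, h6, h7, h8]

end TopologicalPurity

end QuantumDouble

theorem lemma1 {d L M : ℕ} [NeZero d] [NeZero L] [NeZero M]
    (ψ : QuantumDouble.Config d L M → ℂ) (hψ : ψ ∈ QuantumDouble.groundSpace d L M)
    (hnorm : ∑ σ, ‖ψ σ‖ ^ 2 = 1)
    (A B C X A' B' C' : Finset (QuantumDouble.Bond L M))
    (hABC : QuantumDouble.IsAnnular A B C)
    (hpatch : QuantumDouble.InPatch (A ∪ B ∪ C ∪ X))
    (hX : QuantumDouble.LocalDeformation A B C X A' B' C')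
    (hbdry : QuantumDouble.numBdry (A ∪ B ∪ C ∪ X) = QuantumDouble.numBdry (A ∪ B ∪ C)) :
    QuantumDouble.topPurity A' B' C' (QuantumDouble.pureState ψ) =
        QuantumDouble.topPurity A B C (QuantumDouble.pureState ψ) ∧
      QuantumDouble.topPurity A B C (QuantumDouble.pureState ψ) =
        (((2 : ℝ) ^ (-2 * QuantumDouble.topEntropy d) : ℝ) : ℂ) ∧
      (QuantumDouble.bdry (A' ∪ B')).ncard + (QuantumDouble.bdry (B' ∪ C')).ncard =
        (QuantumDouble.bdry B').ncard + (QuantumDouble.bdry (A' ∪ B' ∪ C')).ncard ∧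
      QuantumDouble.shapeCorr d (A' ∪ B') + QuantumDouble.shapeCorr d (B' ∪ C') =
        QuantumDouble.shapeCorr d B' + QuantumDouble.shapeCorr d (A' ∪ B' ∪ C') := by
  obtain ⟨hAC, hunion, hbal⟩ := hX.balance hABC hbdry
  have h0 := QuantumDouble.topPurity_eq hψ hnorm hABC.apart_AC
    (hpatch.mono Finset.subset_union_left) hABC.totalComp_eq
  have h1 := QuantumDouble.topPurity_eq hψ hnorm hAC (by rwa [hunion]) hbal
  exact ⟨h1.trans h0.symm, h0, QuantumDouble.ncard_bdry_add hAC, QuantumDouble.shapeCorr_add d hAC⟩
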